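/- **Setting.** Let $T,M$ be smooth manifolds of dimensions $p,n$, and let $J^1(T,M)$ be their first jet space, with the coordinates $(t^\alpha,x^i,x^i_\alpha)$ induced by charts of $T$ and $M$ (for $p=1$ write $y^i=x^i_1$). Repeated indices are summed. Let $h=(h_{\alpha\beta}(t))$ be a semi-Riemannian metric on $T$ with Christoffel symbols $H^\gamma_{\alpha\beta}$, and let $L:J^1(T,M)\to\mathbb R$ be smooth and Kronecker $h$-regular, that is, $$\tfrac12\frac{\partial^2L}{\partial x^i_\alpha\partial x^j_\beta}=h^{\alpha\beta}g_{ij}$$ with a d-tensor $g_{ij}$ on $J^1(T,M)$ that is symmetric, of rank $n$ and of constant signature. Put $$2\mathcal G^k=\tfrac12g^{ki}\Big\{\frac{\partial^2L}{\partial x^j\partial x^i_\alpha}x^j_\alpha-\frac{\partial L}{\partial x^i}+\frac{\partial^2L}{\partial t^\alpha\partial x^i_\alpha}+\frac{\partial L}{\partial x^i_\alpha}H^\gamma_{\alpha\gamma}+2g_{ij}h^{\alpha\beta}H^\gamma_{\alpha\beta}x^j_\gamma\Big\}.$$ The canonical nonlinear connection is $M^{(i)}_{(\alpha)\beta}=-H^\gamma_{\alpha\beta}x^i_\gamma$,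 $N^{(i)}_{(\alpha)j}=h_{\alpha\gamma}\,\partial\mathcal G^i/\partial x^j_\gamma$. Its adapted basis is $$\frac{\delta}{\delta t^\alpha}=\frac{\partial}{\partial t^\alpha}-M^{(j)}_{(\beta)\alpha}\frac{\partial}{\partial x^j_\beta},\qquad \frac{\delta}{\delta x^i}=\frac{\partial}{\partial x^i}-N^{(j)}_{(\beta)i}\frac{\partial}{\partial x^j_\beta},\qquad \frac{\partial}{\partial x^i_\alpha},$$ and $h_T,h_M,v$ are the corresponding projections. The Cartan canonical connection is the linear connection $\nabla$ such that * $\nabla h_T=\nabla h_M=\nabla v=0$; * $\nabla_{\delta/\delta t^\gamma}\frac{\delta}{\delta t^\beta}=H^\alpha_{\beta\gamma}\frac{\delta}{\delta t^\alpha}$, and $\nabla_{\delta/\delta x^j}\frac{\delta}{\delta t^\beta}=0$, $\nabla_{\partial/\partial x^j_\gamma}\frac{\delta}{\delta t^\beta}=0$; * $\nabla J=0$ for $J=h_{\alpha\beta}\delta^i_j\,\frac{\partial}{\partial x^i_\alpha}\otimes dt^\beta\otimes dx^j$; * the coefficients defined by $\nabla_{\delta/\delta t^\gamma}\frac{\delta}{\delta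 x^i}=G^k_{i\gamma}\frac{\delta}{\delta x^k}$, $\nabla_{\delta/\delta x^j}\frac{\delta}{\delta x^i}=L^k_{ij}\frac{\delta}{\delta x^k}$, $\nabla_{\partial/\partial x^j_\gamma}\frac{\delta}{\delta x^i}=C^{k(\gamma)}_{i(j)}\frac{\delta}{\delta x^k}$ satisfy $$g_{ij|k}=0,\quad g_{ij}|^{(\gamma)}_{(k)}=0,\quad G^k_{j\gamma}=\tfrac12g^{ki}\frac{\delta g_{ij}}{\delta t^\gamma},\quad L^k_{ij}=L^k_{ji},\quad C^{i(\gamma)}_{j(k)}=C^{i(\gamma)}_{k(j)},$$ where $g_{ij|k}=\frac{\delta g_{ij}}{\delta x^k}-g_{mj}L^m_{ik}-g_{im}L^m_{jk}$ and $g_{ij}|^{(\gamma)}_{(k)}=\frac{\partial g_{ij}}{\partial x^k_\gamma}-g_{mj}C^{m(\gamma)}_{i(k)}-g_{im}C^{m(\gamma)}_{j(k)}$. **Theorem.** The torsion $\mathbf T(X,Y)=\nabla_XY-\nabla_YX-[X,Y]$ of the Cartan canonical connection is a tensor, determined by its values on the adapted basis, which are as follows. (i) If $p=1$ (the index $1$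 being the only temporal one): * $\mathbf T(\frac{\delta}{\delta t},\frac{\delta}{\delta t})=0$; * $\mathbf T(\frac{\delta}{\delta x^j},\frac{\delta}{\delta t})=T^m_{1j}\frac{\delta}{\delta x^m}+R^{(m)}_{(1)1j}\frac{\partial}{\partial y^m}$, with $T^m_{1j}=-G^m_{j1}$ and $R^{(m)}_{(1)1j}=-\frac{\partial N^{(m)}_{(1)j}}{\partial t}+H^1_{11}\Big[N^{(m)}_{(1)j}-\frac{\partial N^{(m)}_{(1)j}}{\partial y^k}y^k\Big]$; * $\mathbf T(\frac{\delta}{\delta x^j},\frac{\delta}{\delta x^i})=R^{(m)}_{(1)ij}\frac{\partial}{\partial y^m}$, with $R^{(m)}_{(1)ij}=\frac{\delta N^{(m)}_{(1)i}}{\delta x^j}-\frac{\delta N^{(m)}_{(1)j}}{\delta x^i}$; * $\mathbf T(\frac{\partial}{\partial y^j},\frac{\delta}{\delta t})=P^{(m)\;(1)}_{(1)1(j)}\frac{\partial}{\partial y^m}$, with $P^{(m)\;(1)}_{(1)1(j)}=-G^m_{j1}$; * $\mathbf T(\frac{\partial}{\partial y^j},\frac{\delta}{\delta x^i})=P^{m(1)}_{i(j)}\frac{\delta}{\delta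 x^m}+P^{(m)\;(1)}_{(1)i(j)}\frac{\partial}{\partial y^m}$, with $P^{m(1)}_{i(j)}=C^{m(1)}_{i(j)}$ and $P^{(m)\;(1)}_{(1)i(j)}=\frac{\partial N^{(m)}_{(1)i}}{\partial y^j}-L^m_{ji}$; * $\mathbf T(\frac{\partial}{\partial y^j},\frac{\partial}{\partial y^i})=0$. (ii) If $p\ge2$, then $g_{ij}=g_{ij}(t,x)$ and $L=h^{\alpha\beta}(t)g_{ij}(t,x)x^i_\alpha x^j_\beta+U^{(\alpha)}_{(i)}(t,x)x^i_\alpha+F(t,x)$. Put $$\Gamma^l_{jk}=\tfrac12g^{li}\Big(\frac{\partial g_{ij}}{\partial x^k}+\frac{\partial g_{ik}}{\partial x^j}-\frac{\partial g_{jk}}{\partial x^i}\Big),\qquad U^{(\alpha)}_{(i)j}=\frac{\partial U^{(\alpha)}_{(i)}}{\partial x^j}-\frac{\partial U^{(\alpha)}_{(j)}}{\partial x^i},$$ $$F^m_{i(\mu)}=\tfrac12g^{mk}\Big[\frac{\partial g_{ki}}{\partial t^\mu}+\tfrac12h_{\mu\beta}U^{(\beta)}_{(k)i}\Big],\qquad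 F^m_{i(\mu)|j}=\frac{\delta F^m_{i(\mu)}}{\delta x^j}+F^k_{i(\mu)}L^m_{kj}-F^m_{k(\mu)}L^k_{ij},$$ $$H^\gamma_{\mu\alpha\beta}=\frac{\partial H^\gamma_{\mu\alpha}}{\partial t^\beta}-\frac{\partial H^\gamma_{\mu\beta}}{\partial t^\alpha}+H^\eta_{\mu\alpha}H^\gamma_{\eta\beta}-H^\eta_{\mu\beta}H^\gamma_{\eta\alpha},\qquad r^m_{kij}=\frac{\partial\Gamma^m_{ki}}{\partial x^j}-\frac{\partial\Gamma^m_{kj}}{\partial x^i}+\Gamma^l_{ki}\Gamma^m_{lj}-\Gamma^l_{kj}\Gamma^m_{li}.$$ Then * $\mathbf T(\frac{\delta}{\delta t^\beta},\frac{\delta}{\delta t^\alpha})=R^{(m)}_{(\mu)\alpha\beta}\frac{\partial}{\partial x^m_\mu}$, with $R^{(m)}_{(\mu)\alpha\beta}=-H^\gamma_{\mu\alpha\beta}x^m_\gamma$; * $\mathbf T(\frac{\delta}{\delta x^j},\frac{\delta}{\delta t^\alpha})=T^m_{\alpha j}\frac{\delta}{\delta x^m}+R^{(m)}_{(\mu)\alpha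 j}\frac{\partial}{\partial x^m_\mu}$, with $T^m_{\alpha j}=-G^m_{j\alpha}$ and $R^{(m)}_{(\mu)\alpha j}=-\frac{\partial N^{(m)}_{(\mu)j}}{\partial t^\alpha}+\tfrac12g^{mk}H^\beta_{\mu\alpha}\Big[\frac{\partial g_{jk}}{\partial t^\beta}+\tfrac12h_{\beta\gamma}U^{(\gamma)}_{(k)j}\Big]$; * $\mathbf T(\frac{\delta}{\delta x^j},\frac{\delta}{\delta x^i})=R^{(m)}_{(\mu)ij}\frac{\partial}{\partial x^m_\mu}$, with $R^{(m)}_{(\mu)ij}=r^m_{kij}x^k_\mu+F^m_{i(\mu)|j}-F^m_{j(\mu)|i}$; * $\mathbf T(\frac{\partial}{\partial x^j_\beta},\frac{\delta}{\delta t^\alpha})=P^{(m)\;(\beta)}_{(\mu)\alpha(j)}\frac{\partial}{\partial x^m_\mu}$, with $P^{(m)\;(\beta)}_{(\mu)\alpha(j)}=-\delta^\beta_\mu G^m_{j\alpha}$; * $\mathbf T(\frac{\partial}{\partial x^j_\beta},\frac{\delta}{\delta x^i})=0$ and $\mathbf T(\frac{\partial}{\partial x^j_\beta},\frac{\partial}{\partial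 x^i_\alpha})=0$. -/

import Mathlib

open scoped Manifold ContDiff

noncomputable section

namespace MultiTime

/-! ## Coordinates on the first jet space and partial derivatives -/

/-- Coordinates `(t^α, x^i, x^i_α)` on the first jet space; the last entry is `fun i α => x^i_α`. -/
abbrev JetCoord (p n : ℕ) := (Fin p → ℝ) × (Fin n → ℝ) × (Fin n → Fin p → ℝ)

/-- Vector fields in the coordinates of the first jet space. -/
abbrev VF (p n : ℕ) := JetCoord p n → JetCoord p n

section Partial

variable {p n : ℕ}

/-- `∂f/∂t^α`. -/
def dT (α : Fin p) (f : JetCoord p n → ℝ) (u : JetCoord p n) : ℝ :=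
  fderiv ℝ f u (Pi.single α 1, 0, 0)

/-- `∂f/∂x^i`. -/
def dX (i : Fin n) (f : JetCoord p n → ℝ) (u : JetCoord p n) : ℝ :=
  fderiv ℝ f u (0, Pi.single i 1, 0)

/-- `∂f/∂x^i_α`. -/
def dY (i : Fin n) (α : Fin p) (f : JetCoord p n → ℝ) (u : JetCoord p n) : ℝ :=
  fderiv ℝ f u (0, 0, Pi.single i (Pi.single α 1))

end Partial

/-! ## Local expressions of a Lagrange space and the objects built from them -/

/-- The local expressions `h_{αβ}(t)`, `g_{ij}(t, x, y)`, `L(t, x, y)`. -/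
structure LocalData (p n : ℕ) where
  h : (Fin p → ℝ) → Matrix (Fin p) (Fin p) ℝ
  g : JetCoord p n → Matrix (Fin n) (Fin n) ℝ
  L : JetCoord p n → ℝ

namespace LocalData

variable {p n : ℕ} (D : LocalData p n)

/-- The vertical fundamental metrical d-tensor `½ ∂²L / ∂x^i_α ∂x^j_β`. -/
def vertHess (i : Fin n) (α : Fin p) (j : Fin n) (β : Fin p) (u : JetCoord p n) : ℝ :=
  (1 / 2) * dY i α (dY j β D.L) u

/-- The Christoffel symbols `H^γ_{αβ}` of the temporal metric `h`. -/
def H (γ α β : Fin p) (u : JetCoord p n) : ℝ :=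
  (1 / 2) * ∑ η, (D.h u.1)⁻¹ γ η *
    (dT α (fun w : JetCoord p n => D.h w.1 η β) u + dT β (fun w : JetCoord p n => D.h w.1 η α) u
      - dT η (fun w : JetCoord p n => D.h w.1 α β) u)

/-- The generalized Christoffel symbols `Γ^l_{jk}` of `g`, formed with `∂/∂x`. -/
def Gam (l j k : Fin n) (u : JetCoord p n) : ℝ :=
  (1 / 2) * ∑ i, (D.g u)⁻¹ l i *
    (dX k (fun w => D.g w i j) u + dX j (fun w => D.g w i k) u - dX i (fun w => D.g w j k) u)

/-- The components `𝒢^k` of the spatial `h`-spray read off from the Euler-Lagrange equations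
`Δ_h x^k + 2 𝒢^k = 0` of `L √|h|`. -/
def spray (k : Fin n) (u : JetCoord p n) : ℝ :=
  (1 / 2) * ((1 / 2) * ∑ i, (D.g u)⁻¹ k i *
    ((∑ j, ∑ α, dX j (dY i α D.L) u * u.2.2 j α) - dX i D.L u
      + (∑ α, dT α (dY i α D.L) u)
      + (∑ α, ∑ γ, dY i α D.L u * D.H γ α γ u)
      + 2 * ∑ j, D.g u i j * ∑ α, ∑ β, ∑ γ, (D.h u.1)⁻¹ α β * D.H γ α β u * u.2.2 j γ))

/-- Temporal components `M^{(i)}_{(α)β} = -H^γ_{αβ} x^i_γ` of the canonical nonlinear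
connection. -/
def M (i : Fin n) (α β : Fin p) (u : JetCoord p n) : ℝ :=
  -∑ γ, D.H γ α β u * u.2.2 i γ

/-- Spatial components `N^{(i)}_{(α)j} = h_{αγ} ∂𝒢^i/∂x^j_γ` of the canonical nonlinear
connection. -/
def N (i : Fin n) (α : Fin p) (j : Fin n) (u : JetCoord p n) : ℝ :=
  ∑ γ, D.h u.1 α γ * dY j γ (D.spray i) u

/-! ### The adapted basis -/

/-- `δ/δt^α = ∂/∂t^α - M^{(j)}_{(β)α} ∂/∂x^j_β`. -/
def eT (α : Fin p) : VF p n := fun u => (Pi.single α 1, 0, fun j β => -D.M j β α u)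

/-- `δ/δx^i = ∂/∂x^i - N^{(j)}_{(β)i} ∂/∂x^j_β`. -/
def eX (i : Fin n) : VF p n := fun u => (0, Pi.single i 1, fun j β => -D.N j β i u)

/-- `∂/∂x^i_α`. -/
def eV (_D : LocalData p n) (i : Fin n) (α : Fin p) : VF p n :=
  fun _ => (0, 0, Pi.single i (Pi.single α 1))

/-- The whole adapted basis, as one family. -/
def frame : Fin p ⊕ Fin n ⊕ (Fin n × Fin p) → VF p n
  | .inl α => D.eT α
  | .inr (.inl i) => D.eX i
  | .inr (.inr (i, α)) => D.eV i α

/-- The dual basis `dt^α`, `dx^i`, `δx^i_α = dx^i_α + M^{(i)}_{(α)β} dt^β + N^{(i)}_{(α)j} dx^j`. -/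
def coframe (u v : JetCoord p n) : Fin p ⊕ Fin n ⊕ (Fin n × Fin p) → ℝ
  | .inl α => v.1 α
  | .inr (.inl i) => v.2.1 i
  | .inr (.inr (i, α)) =>
      v.2.2 i α + (∑ β, D.M i α β u * v.1 β) + ∑ j, D.N i α j u * v.2.1 j

/-- The tangent vector `a^α δ/δt^α + b^i δ/δx^i + c^i_α ∂/∂x^i_α` at `u`. -/
def vec (u : JetCoord p n) (a : Fin p → ℝ) (b : Fin n → ℝ) (c : Fin n → Fin p → ℝ) :
    JetCoord p n :=
  (∑ α, a α • D.eT α u) + (∑ i, b i • D.eX i u) + ∑ i, ∑ α, c i α • D.eV i α u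

/-- The projection `h_T`. -/
def projT (u v : JetCoord p n) : JetCoord p n :=
  D.vec u (fun α => D.coframe u v (.inl α)) 0 0

/-- The projection `h_M`. -/
def projM (u v : JetCoord p n) : JetCoord p n :=
  D.vec u 0 (fun i => D.coframe u v (.inr (.inl i))) 0

/-- The projection `v`. -/
def projV (u v : JetCoord p n) : JetCoord p n :=
  D.vec u 0 0 (fun i α => D.coframe u v (.inr (.inr (i, α))))

/-- `δf/δt^α`. -/
def deltaT (α : Fin p) (f : JetCoord p n → ℝ) (u : JetCoord p n) : ℝ := fderiv ℝ f u (D.eT α u)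

/-- `δf/δx^i`. -/
def deltaX (i : Fin n) (f : JetCoord p n → ℝ) (u : JetCoord p n) : ℝ := fderiv ℝ f u (D.eX i u)

/-- The normalization d-tensor `J = h_{αβ} δ^i_j ∂/∂x^i_α ⊗ dt^β ⊗ dx^j`, as a bilinear map with
vertical values. -/
def J (u v w : JetCoord p n) : JetCoord p n :=
  D.vec u 0 0 (fun i α => (∑ β, D.h u.1 α β * v.1 β) * w.2.1 i)

end LocalData

/-! ## Linear connections, torsion, the Cartan connection -/

/-- An operator `cov` with `cov Y u v = (∇_v Y)(u)`. -/
abbrev ConnOp (p n : ℕ) := VF p n → JetCoord p n → (JetCoord p n →L[ℝ] JetCoord p n)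

/-- `∇` is a smooth linear connection on the open set `W` of the coordinate space. -/
structure IsLinearConnection {p n : ℕ} (W : Set (JetCoord p n)) (cov : ConnOp p n) : Prop where
  isCov : IsCovariantDerivativeOn (I := 𝓘(ℝ, JetCoord p n)) (M := JetCoord p n)
    (V := TangentSpace 𝓘(ℝ, JetCoord p n)) (JetCoord p n) cov W
  smooth : ∀ X Y : VF p n, ContDiffOn ℝ ∞ X W → ContDiffOn ℝ ∞ Y W →
    ContDiffOn ℝ ∞ (fun u => cov Y u (X u)) W

/-- The torsion `T(X, Y) = ∇_X Y - ∇_Y X - [X, Y]`. -/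
def torsion {p n : ℕ} (cov : ConnOp p n) (X Y : VF p n) (u : JetCoord p n) : JetCoord p n :=
  cov Y u (X u) - cov X u (Y u) - VectorField.lieBracket ℝ X Y u

namespace LocalData

variable {p n : ℕ} (D : LocalData p n)

/-- `Γ`-linear connection: `∇ h_T = 0`, `∇ h_M = 0`, `∇ v = 0`. -/
structure IsGammaLinear (W : Set (JetCoord p n)) (cov : ConnOp p n) : Prop
    extends IsLinearConnection W cov where
  parT : ∀ Y : VF p n, ContDiffOn ℝ ∞ Y W → ∀ u ∈ W, ∀ v,
    cov (fun w => D.projT w (Y w)) u v = D.projT u (cov Y u v)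
  parM : ∀ Y : VF p n, ContDiffOn ℝ ∞ Y W → ∀ u ∈ W, ∀ v,
    cov (fun w => D.projM w (Y w)) u v = D.projM u (cov Y u v)
  parV : ∀ Y : VF p n, ContDiffOn ℝ ∞ Y W → ∀ u ∈ W, ∀ v,
    cov (fun w => D.projV w (Y w)) u v = D.projV u (cov Y u v)

/-- `h`-normal `Γ`-linear connection: the coefficients of `∇` on `δ/δt^β` are
`(H^α_{βγ}, 0, 0)`, and `∇ J = 0`. -/
structure IsHNormal (W : Set (JetCoord p n)) (cov : ConnOp p n) : Prop
    extends D.IsGammaLinear W cov where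
  barG : ∀ u ∈ W, ∀ β γ, cov (D.eT β) u (D.eT γ u) = ∑ α, D.H α β γ u • D.eT α u
  barL : ∀ u ∈ W, ∀ β j, cov (D.eT β) u (D.eX j u) = 0
  barC : ∀ u ∈ W, ∀ β j γ, cov (D.eT β) u (D.eV j γ u) = 0
  parJ : ∀ X Y : VF p n, ContDiffOn ℝ ∞ X W → ContDiffOn ℝ ∞ Y W → ∀ u ∈ W, ∀ v,
    cov (fun w => D.J w (X w) (Y w)) u v = D.J u (cov X u v) (Y u) + D.J u (X u) (cov Y u v)

/-- The coefficient `G^k_{iγ}`: `∇_{δ/δt^γ} δ/δx^i = G^k_{iγ} δ/δx^k`. -/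
def coefG (cov : ConnOp p n) (k i : Fin n) (γ : Fin p) (u : JetCoord p n) : ℝ :=
  D.coframe u (cov (D.eX i) u (D.eT γ u)) (.inr (.inl k))

/-- The coefficient `L^k_{ij}`: `∇_{δ/δx^j} δ/δx^i = L^k_{ij} δ/δx^k`. -/
def coefL (cov : ConnOp p n) (k i j : Fin n) (u : JetCoord p n) : ℝ :=
  D.coframe u (cov (D.eX i) u (D.eX j u)) (.inr (.inl k))

/-- The coefficient `C^{k(γ)}_{i(j)}`: `∇_{∂/∂x^j_γ} δ/δx^i = C^{k(γ)}_{i(j)} δ/δx^k`. -/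
def coefC (cov : ConnOp p n) (k i j : Fin n) (γ : Fin p) (u : JetCoord p n) : ℝ :=
  D.coframe u (cov (D.eX i) u (D.eV j γ u)) (.inr (.inl k))

/-- The Cartan canonical connection: the `h`-normal `Γ`-linear connection with
`g_{ij|k} = 0`, `g_{ij}|^{(γ)}_{(k)} = 0`, `G^k_{jγ} = ½ g^{ki} δg_{ij}/δt^γ`,
`L^k_{ij} = L^k_{ji}`, `C^{i(γ)}_{j(k)} = C^{i(γ)}_{k(j)}`. -/
structure IsCartan (W : Set (JetCoord p n)) (cov : ConnOp p n) : Prop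
    extends D.IsHNormal W cov where
  metricX : ∀ u ∈ W, ∀ i j k, D.deltaX k (fun w => D.g w i j) u
    - (∑ m, D.g u m j * D.coefL cov m i k u) - (∑ m, D.g u i m * D.coefL cov m j k u) = 0
  metricV : ∀ u ∈ W, ∀ i j k γ, dY k γ (fun w => D.g w i j) u
    - (∑ m, D.g u m j * D.coefC cov m i k γ u) - (∑ m, D.g u i m * D.coefC cov m j k γ u) = 0
  eqG : ∀ u ∈ W, ∀ k j γ, D.coefG cov k j γ u
    = (1 / 2) * ∑ i, (D.g u)⁻¹ k i * D.deltaT γ (fun w => D.g w i j) u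
  symmL : ∀ u ∈ W, ∀ k i j, D.coefL cov k i j u = D.coefL cov k j i u
  symmC : ∀ u ∈ W, ∀ i j k γ, D.coefC cov i j k γ u = D.coefC cov i k j γ u

/-! ### The quantities in the formulas for several times -/

/-- `U^{(α)}_{(i)}(t, x) = ∂L/∂x^i_α (t, x, 0)`, the coefficient of the part of `L` that is linear
in the `x^i_α`. -/
def U (i : Fin n) (α : Fin p) (u : JetCoord p n) : ℝ := dY i α D.L (u.1, u.2.1, 0)

/-- `F(t, x) = L(t, x, 0)`. -/
def pot (u : JetCoord p n) : ℝ := D.L (u.1, u.2.1, 0)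

/-- `U^{(α)}_{(i)j} = ∂U^{(α)}_{(i)}/∂x^j - ∂U^{(α)}_{(j)}/∂x^i`. -/
def curlU (i : Fin n) (α : Fin p) (j : Fin n) (u : JetCoord p n) : ℝ :=
  dX j (D.U i α) u - dX i (D.U j α) u

/-- `F^m_{i(μ)} = ½ g^{mk} (∂g_{ki}/∂t^μ + ½ h_{μβ} U^{(β)}_{(k)i})`. -/
def F (m i : Fin n) (μ : Fin p) (u : JetCoord p n) : ℝ :=
  ∑ k, (D.g u)⁻¹ m k / 2 *
    (dT μ (fun w => D.g w k i) u + (1 / 2) * ∑ β, D.h u.1 μ β * D.curlU k β i u)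

/-- The `M`-horizontal covariant derivative
`F^m_{i(μ)|j} = δF^m_{i(μ)}/δx^j + F^k_{i(μ)} L^m_{kj} - F^m_{k(μ)} L^k_{ij}`; the temporal index
contributes nothing, since the coefficients `L̄` vanish. -/
def covF (cov : ConnOp p n) (m i : Fin n) (μ : Fin p) (j : Fin n) (u : JetCoord p n) : ℝ :=
  D.deltaX j (D.F m i μ) u + (∑ k, D.F k i μ u * D.coefL cov m k j u)
    - ∑ k, D.F m k μ u * D.coefL cov k i j u

/-- `H^γ_{μαβ} = ∂H^γ_{μα}/∂t^β - ∂H^γ_{μβ}/∂t^α + H^η_{μα} H^γ_{ηβ} - H^η_{μβ} H^γ_{ηα}`. -/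
def curvH (γ μ α β : Fin p) (u : JetCoord p n) : ℝ :=
  dT β (D.H γ μ α) u - dT α (D.H γ μ β) u
    + (∑ η, D.H η μ α u * D.H γ η β u) - ∑ η, D.H η μ β u * D.H γ η α u

/-- `r^m_{kij} = ∂Γ^m_{ki}/∂x^j - ∂Γ^m_{kj}/∂x^i + Γ^l_{ki} Γ^m_{lj} - Γ^l_{kj} Γ^m_{li}`. -/
def curvG (m k i j : Fin n) (u : JetCoord p n) : ℝ :=
  dX j (D.Gam m k i) u - dX i (D.Gam m k j) u
    + (∑ l, D.Gam l k i u * D.Gam m l j u) - ∑ l, D.Gam l k j u * D.Gam m l i u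

end LocalData

/-! ## Metrical multi-time Lagrange spaces -/

section Manifold

variable {p n : ℕ}
  {T : Type*} [TopologicalSpace T] [ChartedSpace (Fin p → ℝ) T]
  {M : Type*} [TopologicalSpace M] [ChartedSpace (Fin n → ℝ) M]

/-- The first jet space `J¹(T, M)`: its fibre over `(t, x)` is the space of linear maps from the
tangent space of `T` at `t` to the tangent space of `M` at `x`. -/
structure Jet (p n : ℕ) (T : Type*) [TopologicalSpace T] [ChartedSpace (Fin p → ℝ) T]
    (M : Type*) [TopologicalSpace M] [ChartedSpace (Fin n → ℝ) M] where
  t : T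
  x : M
  A : TangentSpace 𝓘(ℝ, Fin p → ℝ) t →ₗ[ℝ] TangentSpace 𝓘(ℝ, Fin n → ℝ) x

/-- The coordinate vector `∂/∂x^i` of the chart `ψ` at the point with coordinates `x`. -/
def coordVec {d : ℕ} {X : Type*} [TopologicalSpace X] [ChartedSpace (Fin d → ℝ) X]
    (ψ : OpenPartialHomeomorph X (Fin d → ℝ)) (x : Fin d → ℝ) (i : Fin d) :
    TangentSpace 𝓘(ℝ, Fin d → ℝ) (ψ.symm x) :=
  mfderiv 𝓘(ℝ, Fin d → ℝ) 𝓘(ℝ, Fin d → ℝ) ψ.symm x (Pi.single i (1 : ℝ) : Fin d → ℝ)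

/-- The jet with coordinates `(t, x, y)` in the charts `φ`, `ψ`: the linear map sends `∂/∂t^α` to
`y^i_α ∂/∂x^i`. -/
def jetOf (φ : OpenPartialHomeomorph T (Fin p → ℝ)) (ψ : OpenPartialHomeomorph M (Fin n → ℝ))
    (u : JetCoord p n) : Jet p n T M where
  t := φ.symm u.1
  x := ψ.symm u.2.1
  A := (mfderiv 𝓘(ℝ, Fin n → ℝ) 𝓘(ℝ, Fin n → ℝ) ψ.symm u.2.1).toLinearMap ∘ₗ
    (Matrix.toLin' (Matrix.of u.2.2) : (Fin p → ℝ) →ₗ[ℝ] (Fin n → ℝ)) ∘ₗ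
    (mfderiv 𝓘(ℝ, Fin p → ℝ) 𝓘(ℝ, Fin p → ℝ) φ (φ.symm u.1)).toLinearMap

/-- The domain of the coordinates on `J¹(T, M)` induced by the charts `φ`, `ψ`. -/
def chartDomain (φ : OpenPartialHomeomorph T (Fin p → ℝ))
    (ψ : OpenPartialHomeomorph M (Fin n → ℝ)) : Set (JetCoord p n) :=
  {u | u.1 ∈ φ.target ∧ u.2.1 ∈ ψ.target}

/-- Local expressions, in the charts `φ`, `ψ`, of a bilinear form field `h` on `T`, a field `g` of
bilinear forms on the tangent spaces of `M` depending on the jet, and a function `L` of the jet. -/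
def localData
    (h : ∀ t : T, LinearMap.BilinForm ℝ (TangentSpace 𝓘(ℝ, Fin p → ℝ) t))
    (g : ∀ u : Jet p n T M, LinearMap.BilinForm ℝ (TangentSpace 𝓘(ℝ, Fin n → ℝ) u.x))
    (L : Jet p n T M → ℝ)
    (φ : OpenPartialHomeomorph T (Fin p → ℝ)) (ψ : OpenPartialHomeomorph M (Fin n → ℝ)) :
    LocalData p n where
  h := fun t => Matrix.of fun α β => h (φ.symm t) (coordVec φ t α) (coordVec φ t β)
  g := fun u => Matrix.of fun i j =>
    g (jetOf φ ψ u) (coordVec ψ u.2.1 i) (coordVec ψ u.2.1 j)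
  L := fun u => L (jetOf φ ψ u)

end Manifold

/-- A metrical multi-time Lagrange space on `J¹(T, M)`: a semi-Riemannian metric `h` on `T`
and a smooth Lagrangian function `L` that is Kronecker `h`-regular, with spatial metrical d-tensor
`g` (symmetric, of rank `n`, of constant signature). Smoothness means smoothness of the components
in all charts. -/
structure LagrangeSpace (p n : ℕ)
    (T : Type*) [TopologicalSpace T] [ChartedSpace (Fin p → ℝ) T]
    [IsManifold 𝓘(ℝ, Fin p → ℝ) ∞ T]
    (M : Type*) [TopologicalSpace M] [ChartedSpace (Fin n → ℝ) M]
    [IsManifold 𝓘(ℝ, Fin n → ℝ) ∞ M] where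
  h : ∀ t : T, LinearMap.BilinForm ℝ (TangentSpace 𝓘(ℝ, Fin p → ℝ) t)
  h_symm : ∀ t, (h t).IsSymm
  h_nondeg : ∀ t, (h t).Nondegenerate
  h_signature : ∃ q : ℕ, ∀ t, sigNeg (h t).toQuadraticMap = q
  L : Jet p n T M → ℝ
  g : ∀ u : Jet p n T M, LinearMap.BilinForm ℝ (TangentSpace 𝓘(ℝ, Fin n → ℝ) u.x)
  g_symm : ∀ u, (g u).IsSymm
  g_nondeg : ∀ u, (g u).Nondegenerate
  g_signature : ∃ q : ℕ, ∀ u, sigNeg (g u).toQuadraticMap = q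
  h_smooth : ∀ φ ∈ IsManifold.maximalAtlas 𝓘(ℝ, Fin p → ℝ) ∞ T,
    ∀ ψ ∈ IsManifold.maximalAtlas 𝓘(ℝ, Fin n → ℝ) ∞ M, ∀ α β,
      ContDiffOn ℝ ∞ (fun t => (localData h g L φ ψ).h t α β) φ.target
  g_smooth : ∀ φ ∈ IsManifold.maximalAtlas 𝓘(ℝ, Fin p → ℝ) ∞ T,
    ∀ ψ ∈ IsManifold.maximalAtlas 𝓘(ℝ, Fin n → ℝ) ∞ M, ∀ i j,
      ContDiffOn ℝ ∞ (fun u => (localData h g L φ ψ).g u i j) (chartDomain φ ψ)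
  L_smooth : ∀ φ ∈ IsManifold.maximalAtlas 𝓘(ℝ, Fin p → ℝ) ∞ T,
    ∀ ψ ∈ IsManifold.maximalAtlas 𝓘(ℝ, Fin n → ℝ) ∞ M,
      ContDiffOn ℝ ∞ (localData h g L φ ψ).L (chartDomain φ ψ)
  regular : ∀ φ ∈ IsManifold.maximalAtlas 𝓘(ℝ, Fin p → ℝ) ∞ T,
    ∀ ψ ∈ IsManifold.maximalAtlas 𝓘(ℝ, Fin n → ℝ) ∞ M,
      ∀ u ∈ chartDomain φ ψ, ∀ i α j β,
        (localData h g L φ ψ).vertHess i α j β u =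
          ((localData h g L φ ψ).h u.1)⁻¹ α β * (localData h g L φ ψ).g u i j

/-- The local expressions of the space in the charts `φ`, `ψ`. -/
def LagrangeSpace.loc {p n : ℕ}
    {T : Type*} [TopologicalSpace T] [ChartedSpace (Fin p → ℝ) T]
    [IsManifold 𝓘(ℝ, Fin p → ℝ) ∞ T]
    {M : Type*} [TopologicalSpace M] [ChartedSpace (Fin n → ℝ) M]
    [IsManifold 𝓘(ℝ, Fin n → ℝ) ∞ M] (S : LagrangeSpace p n T M)
    (φ : OpenPartialHomeomorph T (Fin p → ℝ)) (ψ : OpenPartialHomeomorph M (Fin n → ℝ)) :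
    LocalData p n :=
  localData S.h S.g S.L φ ψ

end MultiTime

end

/-! In a pair of charts everything lives on an open set of `ℝ^p × ℝ^n × ℝ^(np)` whose fibres are
whole vector spaces. The torsion is function-bilinear, because the Leibniz terms of `∇` are exactly
those of the Lie bracket (`torsion_sum`, `torsion_eq_sum`), so only its values on the adapted basis
matter.

For those values two ingredients suffice, for every `p`. The base components of the adapted fields
are constant, so their brackets are vertical and are given by derivatives of `M` and `N`. The
covariant derivatives are also forced: on `δ/δt` they are prescribed; `∇ h_M = 0` keeps `∇ δ/δx`
inside the span of the `δ/δx` (`cov_eX`); and `J(δ/δt^β, δ/δx^i) = h_{αβ} ∂/∂x^i_α` together with `∇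
J = 0`, the compatibility of `H` with `h` and the invertibility of `h` determines `∇ ∂/∂x^i_α`
(`cov_eV`). The lemmas `torsion_eT_eT` to `torsion_eV_eV` combine the two. For one time it remains
to identify all temporal indices and to expand `δM/δx` and `δN/δt`.

For several times the new input is rigidity of `g` (`dY_g`). Symmetry of the third vertical
derivatives of `L` gives `h^{αβ} ∂g_{ij}/∂x^k_γ = h^{γβ} ∂g_{kj}/∂x^i_α`; contracting with `h_{βα}`
for some `α ≠ γ` gives `∂g_{ij}/∂x^k_γ = 0`. Hence `g` lives on `(t, x)`, `L` is quadratic on the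
fibres, and `N = Γ y + F` is affine there (`N_eq`), the terms of the spray with `H` cancelling by
`trace_dT_hinv`. Koszul's argument then yields `L^k_{ij} = Γ^k_{ij}` and `C = 0` (`coefL_eq`,
`coefC_eq_zero`), and substitution into the general rows gives the stated components. -/

namespace MultiTime

/-! ## Differential calculus on open sets -/

section Calculus

variable {E : Type*} [NormedAddCommGroup E] [NormedSpace ℝ E] {W : Set E} {f g : E → ℝ} {u : E}

theorem differentiableAt_of_smooth {F : Type*} [NormedAddCommGroup F] [NormedSpace ℝ F] {f : E → F}
    (hW : IsOpen W) (hf : ContDiffOn ℝ ∞ f W) (hu : u ∈ W) : DifferentiableAt ℝ f u :=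
  (hf.contDiffAt (hW.mem_nhds hu)).differentiableAt (by simp)

theorem smooth_fderiv {v : E → E} (hW : IsOpen W) (hf : ContDiffOn ℝ ∞ f W)
    (hv : ContDiffOn ℝ ∞ v W) : ContDiffOn ℝ ∞ (fun w => fderiv ℝ f w (v w)) W :=
  (hf.fderiv_of_isOpen hW (by simp)).clm_apply hv

theorem fderiv_congr_on (hW : IsOpen W) (h : ∀ w ∈ W, f w = g w) (hu : u ∈ W) (v : E) :
    fderiv ℝ f u v = fderiv ℝ g u v := by
  rw [Filter.EventuallyEq.fderiv_eq (Filter.eventually_of_mem (hW.mem_nhds hu) h)]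

theorem fderiv_mul_apply (hf : DifferentiableAt ℝ f u) (hg : DifferentiableAt ℝ g u) (v : E) :
    fderiv ℝ (fun w => f w * g w) u v = f u * fderiv ℝ g u v + fderiv ℝ f u v * g u := by
  rw [fderiv_fun_mul hf hg]
  simp [mul_comm]

theorem fderiv_add_apply' (hf : DifferentiableAt ℝ f u) (hg : DifferentiableAt ℝ g u) (v : E) :
    fderiv ℝ (fun w => f w + g w) u v = fderiv ℝ f u v + fderiv ℝ g u v := by
  rw [fderiv_fun_add hf hg]; rfl

theorem fderiv_sub_apply' (hf : DifferentiableAt ℝ f u) (hg : DifferentiableAt ℝ g u) (v : E) :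
    fderiv ℝ (fun w => f w - g w) u v = fderiv ℝ f u v - fderiv ℝ g u v := by
  rw [fderiv_fun_sub hf hg]; rfl

theorem fderiv_neg_apply' (v : E) :
    fderiv ℝ (fun w => - f w) u v = - fderiv ℝ f u v := by
  rw [fderiv_fun_neg]; rfl

theorem fderiv_const_mul_apply (hf : DifferentiableAt ℝ f u) (c : ℝ) (v : E) :
    fderiv ℝ (fun w => c * f w) u v = c * fderiv ℝ f u v := by
  rw [fderiv_const_mul hf]; rfl

theorem fderiv_sum_apply' {ι : Type*} [Fintype ι] {F : ι → E → ℝ}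
    (hF : ∀ i, DifferentiableAt ℝ (F i) u) (v : E) :
    fderiv ℝ (fun w => ∑ i, F i w) u v = ∑ i, fderiv ℝ (F i) u v := by
  rw [fderiv_fun_sum fun i _ => hF i]; simp

/-- Directional derivatives of a smooth function commute. -/
theorem fderiv_comm (hW : IsOpen W) (hf : ContDiffOn ℝ ∞ f W) (hu : u ∈ W) (v w : E) :
    fderiv ℝ (fun a => fderiv ℝ f a v) u w = fderiv ℝ (fun a => fderiv ℝ f a w) u v := by
  have hd : DifferentiableAt ℝ (fderiv ℝ f) u :=
    differentiableAt_of_smooth hW (hf.fderiv_of_isOpen hW (m := ∞) (by simp)) hu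
  have hs : IsSymmSndFDerivAt ℝ f u := by
    apply ContDiffAt.isSymmSndFDerivAt (n := ∞) (hf.contDiffAt (hW.mem_nhds hu))
    rw [minSmoothness_of_isRCLikeNormedField]
    exact WithTop.coe_le_coe.2 le_top
  have key : ∀ v w : E, fderiv ℝ (fun a => fderiv ℝ f a v) u w = fderiv ℝ (fderiv ℝ f) u w v := by
    intro v w
    rw [fderiv_clm_apply hd (differentiableAt_const v)]
    simp
  rw [key, key, hs.eq]

/-- Cramer's rule: each entry of the inverse is a quotient of determinants, which are polynomials in
the entries. -/
theorem smooth_matrix_inv {m : ℕ} {A : E → Matrix (Fin m) (Fin m) ℝ}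
    (hA : ∀ i j, ContDiffOn ℝ ∞ (fun w => A w i j) W) (hdet : ∀ w ∈ W, (A w).det ≠ 0)
    (i j : Fin m) : ContDiffOn ℝ ∞ (fun w => (A w)⁻¹ i j) W := by
  have det_smooth : ∀ B : E → Matrix (Fin m) (Fin m) ℝ,
      (∀ i j, ContDiffOn ℝ ∞ (fun w => B w i j) W) → ContDiffOn ℝ ∞ (fun w => (B w).det) W := by
    intro B hB
    simp only [Matrix.det_apply]
    exact ContDiffOn.sum fun σ _ => (contDiffOn_prod fun i _ => hB (σ i) i).const_smul _
  have h : (fun w => (A w)⁻¹ i j) = fun w => ((A w).det)⁻¹ * ((A w).updateRow j (Pi.single i 1)).det := by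
    funext w
    rw [Matrix.inv_def, Ring.inverse_eq_inv', Matrix.smul_apply, Matrix.adjugate_apply, smul_eq_mul]
  rw [h]
  refine ((det_smooth A hA).inv hdet).mul (det_smooth _ fun a b => ?_)
  by_cases hab : a = j
  · subst hab
    simpa using contDiffOn_const
  · simpa [Matrix.updateRow_ne hab] using hA a b

end Calculus

/-! ## The adapted basis -/

namespace LocalData

variable {p n : ℕ} (D : LocalData p n)

theorem vec_eq (u : JetCoord p n) (a : Fin p → ℝ) (b : Fin n → ℝ) (c : Fin n → Fin p → ℝ) :
    D.vec u a b c = (a, b, fun j β => c j β - (∑ α, a α * D.M j β α u) - ∑ i, b i * D.N j β i u) := by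
  refine Prod.ext ?_ (Prod.ext ?_ ?_)
  · funext α
    simp [vec, eT, eX, eV, Prod.fst_sum, Finset.sum_apply, Pi.single_apply]
  · funext i
    simp [vec, eT, eX, eV, Prod.fst_sum, Prod.snd_sum, Finset.sum_apply, Pi.single_apply]
  · funext j β
    have hV : ∀ x : Fin n, (∑ y : Fin p, c x y *
        (Pi.single x (Pi.single y (1 : ℝ)) : Fin n → Fin p → ℝ) j β) = if j = x then c x β else 0 := by
      intro x
      by_cases h : j = x
      · subst h; simp [Pi.single_apply]
      · simp [h]
    simp [vec, eT, eX, eV, Prod.snd_sum, Finset.sum_apply, hV]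
    ring

theorem eX_eq_vec (i : Fin n) (u : JetCoord p n) : D.eX i u = D.vec u 0 (Pi.single i 1) 0 := by
  simp [vec_eq, eX, Pi.single_apply]

theorem vec_vertical (u : JetCoord p n) (c : Fin n → Fin p → ℝ) : D.vec u 0 0 c = (0, 0, c) := by
  simp [vec_eq]

theorem vec_coframe (u v : JetCoord p n) :
    D.vec u (fun α => D.coframe u v (.inl α)) (fun i => D.coframe u v (.inr (.inl i)))
      (fun i α => D.coframe u v (.inr (.inr (i, α)))) = v := by
  rw [vec_eq]
  refine Prod.ext rfl (Prod.ext rfl ?_)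
  funext j β
  simp only [coframe, mul_comm (v.1 _), mul_comm (v.2.1 _)]
  ring

theorem sum_coframe_smul_frame (u v : JetCoord p n) : ∑ a, D.coframe u v a • D.frame a u = v := by
  conv_rhs => rw [← D.vec_coframe u v]
  simp only [Fintype.sum_sum_type, Fintype.sum_prod_type, frame, vec]
  abel

theorem coframe_vec_inr_inl (u : JetCoord p n) (a : Fin p → ℝ) (b : Fin n → ℝ)
    (c : Fin n → Fin p → ℝ) (i : Fin n) : D.coframe u (D.vec u a b c) (.inr (.inl i)) = b i := by
  simp [vec_eq, coframe]

/-- This makes `∇ h_M = 0` applicable to `δ/δx^i`. -/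
theorem projM_eX (i : Fin n) (u : JetCoord p n) : D.projM u (D.eX i u) = D.eX i u := by
  rw [projM, eX_eq_vec]
  simp only [coframe_vec_inr_inl]

end LocalData

/-! ## Linear connections -/

section Connection

variable {p n : ℕ} {W : Set (JetCoord p n)} {cov : ConnOp p n} {u : JetCoord p n}

/-- The tangent bundle of a vector space is trivialized by the identity, so ordinary
differentiability of a field is what the axioms of a covariant derivative ask of a section. -/
theorem mdifferentiableAt_field {E : Type*} [NormedAddCommGroup E] [NormedSpace ℝ E]
    {X : ∀ w : E, TangentSpace 𝓘(ℝ, E) w} {u : E} (hX : DifferentiableAt ℝ (F := E) X u) :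
    MDifferentiableAt 𝓘(ℝ, E) (𝓘(ℝ, E).prod 𝓘(ℝ, E))
      (fun w => (⟨w, X w⟩ : TangentBundle 𝓘(ℝ, E) E)) u := by
  rw [mdifferentiableAt_totalSpace]
  refine ⟨mdifferentiableAt_id, ?_⟩
  simp only [trivializationAt_model_space_apply]
  exact hX.mdifferentiableAt

namespace IsLinearConnection

theorem cov_add (hc : IsLinearConnection W cov) (hu : u ∈ W) {X Y : VF p n}
    (hX : DifferentiableAt ℝ X u) (hY : DifferentiableAt ℝ Y u) (v : JetCoord p n) :
    cov (fun w => X w + Y w) u v = cov X u v + cov Y u v := by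
  have h := hc.isCov.add (σ := X) (σ' := Y) (x := u) (mdifferentiableAt_field hX)
    (mdifferentiableAt_field hY) hu
  exact congrArg (fun A => A v) h

theorem cov_smul (hc : IsLinearConnection W cov) (hu : u ∈ W) {X : VF p n} {f : JetCoord p n → ℝ}
    (hX : DifferentiableAt ℝ X u) (hf : DifferentiableAt ℝ f u) (v : JetCoord p n) :
    cov (fun w => f w • X w) u v = f u • cov X u v + fderiv ℝ f u v • X u := by
  have h := hc.isCov.leibniz (σ := X) (g := f) (x := u) (mdifferentiableAt_field hX)
    hf.mdifferentiableAt hu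
  have h2 := congrArg (fun A => A v) h
  rw [← mfderiv_eq_fderiv]
  exact h2

end IsLinearConnection
end Connection
section Connection

variable {p n : ℕ} {W : Set (JetCoord p n)} {cov : ConnOp p n} {u : JetCoord p n}

theorem IsLinearConnection.cov_sum {ι : Type*} [Fintype ι] (hc : IsLinearConnection W cov)
    (hu : u ∈ W) {X : ι → VF p n} {f : ι → JetCoord p n → ℝ}
    (hX : ∀ a, DifferentiableAt ℝ (X a) u) (hf : ∀ a, DifferentiableAt ℝ (f a) u)
    (v : JetCoord p n) :
    cov (fun w => ∑ a, f a w • X a w) u v =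
      ∑ a, (f a u • cov (X a) u v + fderiv ℝ (f a) u v • X a u) := by
  classical
  suffices h : ∀ s : Finset ι, cov (fun w => ∑ a ∈ s, f a w • X a w) u v =
      ∑ a ∈ s, (f a u • cov (X a) u v + fderiv ℝ (f a) u v • X a u) from h _
  intro s
  induction s using Finset.induction_on with
  | empty =>
    -- That `∇` kills the zero field is read off from the Leibniz rule with zero coefficient.
    have h := hc.cov_smul hu (X := fun _ => 0) (f := fun _ => 0)
      (differentiableAt_const _) (differentiableAt_const _) v
    simpa using h
  | insert a s ha ih =>
    have hd : ∀ b, DifferentiableAt ℝ (fun w => f b w • X b w) u := fun b => (hf b).smul (hX b)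
    simp only [Finset.sum_insert ha]
    rw [hc.cov_add hu (hd a) (DifferentiableAt.fun_sum fun b _ => hd b), ih,
      hc.cov_smul hu (hX a) (hf a)]

theorem torsion_swap (X Y : VF p n) : torsion cov X Y u = -torsion cov Y X u := by
  rw [torsion, torsion, VectorField.lieBracket_swap]
  abel

/-- The terms `(Y f) X` from `∇_Y (f X)` and from `[f X, Y]` cancel; this is the tensor property in
the first slot. -/
theorem IsLinearConnection.torsion_sum {ι : Type*} [Fintype ι] (hc : IsLinearConnection W cov)
    (hu : u ∈ W) {X : ι → VF p n} {f : ι → JetCoord p n → ℝ}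
    (hX : ∀ a, DifferentiableAt ℝ (X a) u) (hf : ∀ a, DifferentiableAt ℝ (f a) u) (Y : VF p n) :
    torsion cov (fun w => ∑ a, f a w • X a w) Y u = ∑ a, f a u • torsion cov (X a) Y u := by
  have hd : ∀ b, DifferentiableAt ℝ (fun w => f b w • X b w) u := fun b => (hf b).smul (hX b)
  simp only [torsion, VectorField.lieBracket_eq, hc.cov_sum hu hX hf, map_sum, map_smul]
  rw [fderiv_fun_sum fun b _ => hd b]
  simp only [fderiv_fun_smul (hf _) (hX _)]
  simp only [sum_apply, add_apply,
    smul_apply, ContinuousLinearMap.smulRight_apply, smul_sub,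
    Finset.sum_sub_distrib, Finset.sum_add_distrib]
  abel

end Connection

/-! ## Regular local expressions -/

/-- The coordinate domain of the jet space over `A ⊆ ℝ^p`, `B ⊆ ℝ^n`. -/
def jetOver {p n : ℕ} (A : Set (Fin p → ℝ)) (B : Set (Fin n → ℝ)) : Set (JetCoord p n) :=
  {u | u.1 ∈ A ∧ u.2.1 ∈ B}

theorem isOpen_jetOver {p n : ℕ} {A : Set (Fin p → ℝ)} {B : Set (Fin n → ℝ)} (hA : IsOpen A)
    (hB : IsOpen B) : IsOpen (jetOver A B) :=
  (hA.preimage continuous_fst).inter (hB.preimage (continuous_fst.comp continuous_snd))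

namespace LocalData

variable {p n : ℕ} {D : LocalData p n} {A : Set (Fin p → ℝ)} {B : Set (Fin n → ℝ)}
  {u : JetCoord p n}

/-- The properties of the local expressions of a Lagrange space over open sets. -/
structure IsRegularOn (D : LocalData p n) (A : Set (Fin p → ℝ)) (B : Set (Fin n → ℝ)) : Prop where
  openA : IsOpen A
  openB : IsOpen B
  h_symm : ∀ t α β, D.h t α β = D.h t β α
  h_det : ∀ t ∈ A, (D.h t).det ≠ 0
  h_smooth : ∀ α β, ContDiffOn ℝ ∞ (fun t => D.h t α β) A
  g_symm : ∀ u i j, D.g u i j = D.g u j i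
  g_det : ∀ u ∈ jetOver A B, (D.g u).det ≠ 0
  g_smooth : ∀ i j, ContDiffOn ℝ ∞ (fun u => D.g u i j) (jetOver A B)
  L_smooth : ContDiffOn ℝ ∞ D.L (jetOver A B)
  hess : ∀ u ∈ jetOver A B, ∀ i α j β, D.vertHess i α j β u = (D.h u.1)⁻¹ α β * D.g u i j

namespace IsRegularOn

theorem isOpen (R : D.IsRegularOn A B) : IsOpen (jetOver A B) := isOpen_jetOver R.openA R.openB

theorem smooth_dT (R : D.IsRegularOn A B) {f : JetCoord p n → ℝ}
    (hf : ContDiffOn ℝ ∞ f (jetOver A B)) (α : Fin p) : ContDiffOn ℝ ∞ (dT α f) (jetOver A B) :=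
  smooth_fderiv R.isOpen hf contDiffOn_const

theorem smooth_dX (R : D.IsRegularOn A B) {f : JetCoord p n → ℝ}
    (hf : ContDiffOn ℝ ∞ f (jetOver A B)) (i : Fin n) : ContDiffOn ℝ ∞ (dX i f) (jetOver A B) :=
  smooth_fderiv R.isOpen hf contDiffOn_const

theorem smooth_dY (R : D.IsRegularOn A B) {f : JetCoord p n → ℝ}
    (hf : ContDiffOn ℝ ∞ f (jetOver A B)) (i : Fin n) (α : Fin p) :
    ContDiffOn ℝ ∞ (dY i α f) (jetOver A B) :=
  smooth_fderiv R.isOpen hf contDiffOn_const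

theorem smooth_h (R : D.IsRegularOn A B) (α β : Fin p) :
    ContDiffOn ℝ ∞ (fun u : JetCoord p n => D.h u.1 α β) (jetOver A B) :=
  (R.h_smooth α β).comp contDiff_fst.contDiffOn fun _ hu => hu.1

theorem smooth_hinv (R : D.IsRegularOn A B) (α β : Fin p) :
    ContDiffOn ℝ ∞ (fun u : JetCoord p n => (D.h u.1)⁻¹ α β) (jetOver A B) :=
  smooth_matrix_inv R.smooth_h (fun u hu => R.h_det u.1 hu.1) α β

theorem smooth_ginv (R : D.IsRegularOn A B) (i j : Fin n) :
    ContDiffOn ℝ ∞ (fun u => (D.g u)⁻¹ i j) (jetOver A B) :=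
  smooth_matrix_inv R.g_smooth R.g_det i j

theorem smooth_y (i : Fin n) (α : Fin p) :
    ContDiffOn ℝ ∞ (fun u : JetCoord p n => u.2.2 i α) (jetOver A B) := by
  fun_prop

theorem smooth_H (R : D.IsRegularOn A B) (γ α β : Fin p) :
    ContDiffOn ℝ ∞ (D.H γ α β) (jetOver A B) :=
  contDiffOn_const.mul (ContDiffOn.sum fun η _ => (R.smooth_hinv γ η).mul
    (((R.smooth_dT (R.smooth_h η β) α).add (R.smooth_dT (R.smooth_h η α) β)).sub
      (R.smooth_dT (R.smooth_h α β) η)))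

theorem smooth_Gam (R : D.IsRegularOn A B) (l j k : Fin n) :
    ContDiffOn ℝ ∞ (D.Gam l j k) (jetOver A B) :=
  contDiffOn_const.mul (ContDiffOn.sum fun i _ => (R.smooth_ginv l i).mul
    (((R.smooth_dX (R.g_smooth i j) k).add (R.smooth_dX (R.g_smooth i k) j)).sub
      (R.smooth_dX (R.g_smooth j k) i)))

theorem smooth_spray (R : D.IsRegularOn A B) (k : Fin n) :
    ContDiffOn ℝ ∞ (D.spray k) (jetOver A B) := by
  have hL := R.smooth_dY R.L_smooth
  refine contDiffOn_const.mul (contDiffOn_const.mul (ContDiffOn.sum fun i _ =>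
    (R.smooth_ginv k i).mul (((((ContDiffOn.sum fun j _ => ContDiffOn.sum fun α _ =>
      (R.smooth_dX (hL i α) j).mul (smooth_y j α)).sub (R.smooth_dX R.L_smooth i)).add
      (ContDiffOn.sum fun α _ => R.smooth_dT (hL i α) α)).add
      (ContDiffOn.sum fun α _ => ContDiffOn.sum fun γ _ => (hL i α).mul (R.smooth_H γ α γ))).add
      (contDiffOn_const.mul (ContDiffOn.sum fun j _ => (R.g_smooth i j).mul
        (ContDiffOn.sum fun α _ => ContDiffOn.sum fun β _ => ContDiffOn.sum fun γ _ =>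
          ((R.smooth_hinv α β).mul (R.smooth_H γ α β)).mul (smooth_y j γ)))))))

theorem smooth_M (R : D.IsRegularOn A B) (i : Fin n) (α β : Fin p) :
    ContDiffOn ℝ ∞ (D.M i α β) (jetOver A B) :=
  (ContDiffOn.sum fun γ _ => (R.smooth_H γ α β).mul (smooth_y i γ)).neg

theorem smooth_N (R : D.IsRegularOn A B) (i : Fin n) (α : Fin p) (j : Fin n) :
    ContDiffOn ℝ ∞ (D.N i α j) (jetOver A B) :=
  ContDiffOn.sum fun γ _ => (R.smooth_h α γ).mul (R.smooth_dY (R.smooth_spray i) j γ)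

theorem smooth_eT (R : D.IsRegularOn A B) (α : Fin p) :
    ContDiffOn ℝ ∞ (D.eT α) (jetOver A B) :=
  contDiffOn_const.prodMk (contDiffOn_const.prodMk (contDiffOn_pi.2 fun j => contDiffOn_pi.2 fun β =>
    (R.smooth_M j β α).neg))

theorem smooth_eX (R : D.IsRegularOn A B) (i : Fin n) :
    ContDiffOn ℝ ∞ (D.eX i) (jetOver A B) :=
  contDiffOn_const.prodMk (contDiffOn_const.prodMk (contDiffOn_pi.2 fun j => contDiffOn_pi.2 fun β =>
    (R.smooth_N j β i).neg))

theorem smooth_eV (D : LocalData p n) (i : Fin n) (α : Fin p) : ContDiffOn ℝ ∞ (D.eV i α) (jetOver A B) :=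
  contDiffOn_const

theorem smooth_frame (R : D.IsRegularOn A B) :
    ∀ a, ContDiffOn ℝ ∞ (D.frame a) (jetOver A B)
  | .inl α => R.smooth_eT α
  | .inr (.inl i) => R.smooth_eX i
  | .inr (.inr (i, α)) => smooth_eV D i α

theorem smooth_coframe (R : D.IsRegularOn A B) {X : VF p n}
    (hX : ContDiffOn ℝ ∞ X (jetOver A B)) :
    ∀ a, ContDiffOn ℝ ∞ (fun w => D.coframe w (X w) a) (jetOver A B) := by
  have h1 : ∀ α, ContDiffOn ℝ ∞ (fun w => (X w).1 α) (jetOver A B) := fun α =>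
    contDiffOn_pi.1 hX.fst α
  have h2 : ∀ i, ContDiffOn ℝ ∞ (fun w => (X w).2.1 i) (jetOver A B) := fun i =>
    contDiffOn_pi.1 hX.snd.fst i
  have h3 : ∀ i α, ContDiffOn ℝ ∞ (fun w => (X w).2.2 i α) (jetOver A B) := fun i α =>
    contDiffOn_pi.1 (contDiffOn_pi.1 hX.snd.snd i) α
  rintro (α | i | ⟨i, α⟩)
  · exact h1 α
  · exact h2 i
  · exact ((h3 i α).add (ContDiffOn.sum fun β _ => (R.smooth_M i α β).mul (h1 β))).add
      (ContDiffOn.sum fun j _ => (R.smooth_N i α j).mul (h2 j))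

theorem diffAt (R : D.IsRegularOn A B) {F : Type*} [NormedAddCommGroup F] [NormedSpace ℝ F]
    {f : JetCoord p n → F} (hf : ContDiffOn ℝ ∞ f (jetOver A B)) (hu : u ∈ jetOver A B) :
    DifferentiableAt ℝ f u :=
  differentiableAt_of_smooth R.isOpen hf hu

/-- The torsion is a tensor, determined by its components in the adapted basis. -/
theorem torsion_eq_sum (R : D.IsRegularOn A B) {cov : ConnOp p n}
    (hc : IsLinearConnection (jetOver A B) cov) (hu : u ∈ jetOver A B) {X Y : VF p n}
    (hX : ContDiffOn ℝ ∞ X (jetOver A B)) (hY : ContDiffOn ℝ ∞ Y (jetOver A B)) :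
    torsion cov X Y u = ∑ a, ∑ b, (D.coframe u (X u) a * D.coframe u (Y u) b) •
      torsion cov (D.frame a) (D.frame b) u := by
  have expand : ∀ {X : VF p n}, ContDiffOn ℝ ∞ X (jetOver A B) → ∀ Y : VF p n,
      torsion cov X Y u = ∑ a, D.coframe u (X u) a • torsion cov (D.frame a) Y u := by
    intro X hX Y
    have h := hc.torsion_sum hu (X := D.frame) (f := fun a w => D.coframe w (X w) a)
      (fun a => R.diffAt (R.smooth_frame a) hu) (fun a => R.diffAt (R.smooth_coframe hX a) hu) Y
    simpa only [sum_coframe_smul_frame] using h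
  rw [expand hX]
  refine Finset.sum_congr rfl fun a _ => ?_
  -- Antisymmetry reduces the second slot to the first.
  rw [torsion_swap, expand hY, ← Finset.sum_neg_distrib, Finset.smul_sum]
  refine Finset.sum_congr rfl fun b _ => ?_
  rw [torsion_swap (D.frame a), smul_neg, smul_neg, mul_smul]

end IsRegularOn

end LocalData

/-! ## Algebra of Christoffel symbols -/

section Algebra

variable {m : ℕ} {g : Matrix (Fin m) (Fin m) ℝ}

theorem sum_mul_sum_inv_mul (hg : g.det ≠ 0) (x : Fin m → ℝ) (a : Fin m) :
    ∑ l, g a l * ∑ i, g⁻¹ l i * x i = x a := by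
  have h : g.mulVec (g⁻¹.mulVec x) = x := by
    rw [Matrix.mulVec_mulVec, Matrix.mul_nonsing_inv _ (isUnit_iff_ne_zero.2 hg), Matrix.one_mulVec]
  exact congrFun h a

theorem sum_inv_mul_sum_mul (hg : g.det ≠ 0) (x : Fin m → ℝ) (a : Fin m) :
    ∑ l, g⁻¹ a l * ∑ i, g l i * x i = x a := by
  have h : g⁻¹.mulVec (g.mulVec x) = x := by
    rw [Matrix.mulVec_mulVec, Matrix.nonsing_inv_mul _ (isUnit_iff_ne_zero.2 hg), Matrix.one_mulVec]
  exact congrFun h a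

theorem eq_of_sum_mul_eq (hg : g.det ≠ 0) {x y : Fin m → ℝ}
    (h : ∀ a, ∑ i, g a i * x i = ∑ i, g a i * y i) : x = y := by
  funext a
  rw [← sum_inv_mul_sum_mul hg x, ← sum_inv_mul_sum_mul hg y]
  simp only [h]

variable {A Λ : Fin m → Fin m → Fin m → ℝ}

/-- The Christoffel symbols of `g` formed with the derivatives `A k i j = ∂_k g_{ij}` are
compatible with `g`. -/
theorem christoffel_metric (hg : g.det ≠ 0) (hs : ∀ i j, g i j = g j i)
    (hA : ∀ k i j, A k i j = A k j i)
    (hΛ : ∀ l j k, Λ l j k = (1 / 2) * ∑ i, g⁻¹ l i * (A k i j + A j i k - A i j k)) (k i j : Fin m) :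
    A k i j = (∑ l, g l j * Λ l i k) + ∑ l, g i l * Λ l j k := by
  -- Lowering the upper index gives the symbols of the first kind; in the sum of two of them all but
  -- `A k i j` cancels.
  have low : ∀ a j k, ∑ l, g a l * Λ l j k = (1 / 2) * (A k a j + A j a k - A a j k) := by
    intro a j k
    rw [← sum_mul_sum_inv_mul hg (fun i => A k i j + A j i k - A i j k) a, Finset.mul_sum]
    refine Finset.sum_congr rfl fun l _ => ?_
    rw [hΛ]
    ring
  simp only [fun l => hs l j, low]
  rw [hA k j i, hA i j k, hA j i k]
  ring

/-- A symmetric family of coefficients that is compatible with `g` consists of the Christoffel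
symbols. -/
theorem christoffel_unique (hg : g.det ≠ 0) (hs : ∀ i j, g i j = g j i)
    (hsymm : ∀ l i j, Λ l i j = Λ l j i)
    (hmet : ∀ k i j, A k i j = (∑ l, g l j * Λ l i k) + ∑ l, g i l * Λ l j k) (l j k : Fin m) :
    Λ l j k = (1 / 2) * ∑ i, g⁻¹ l i * (A k i j + A j i k - A i j k) := by
  -- Koszul's trick: in this combination of three compatibility equations, symmetry of `Λ` leaves
  -- one lowered coefficient.
  have low : ∀ a, (1 / 2) * (A k a j + A j a k - A a j k) = ∑ l, g a l * Λ l j k := by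
    intro a
    rw [hmet k a j, hmet j a k, hmet a j k]
    simp only [fun l => hs l j, fun l => hs l k, fun l => hsymm l a, fun l => hsymm l k j]
    ring
  rw [← sum_inv_mul_sum_mul hg (fun i => Λ i j k) l]
  simp only [← low]
  rw [Finset.mul_sum]
  exact Finset.sum_congr rfl fun i _ => by ring

/-- Koszul's argument with vanishing derivatives of `g`; it serves to kill the coefficients `C` when
`g` does not depend on the fibre. -/
theorem eq_zero_of_metric (hg : g.det ≠ 0) (hs : ∀ i j, g i j = g j i)
    (hsymm : ∀ l i j, Λ l i j = Λ l j i)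
    (hmet : ∀ k i j, (∑ l, g l j * Λ l i k) + ∑ l, g i l * Λ l j k = 0) (l j k : Fin m) :
    Λ l j k = 0 := by
  rw [christoffel_unique (A := fun _ _ _ => 0) hg hs hsymm (fun k i j => (hmet k i j).symm)]
  simp

end Algebra

/-! ## Directional derivatives on the jet space -/

section Jet

variable {p n : ℕ} {u : JetCoord p n}

/-- The fields of the adapted basis have this shape, which is why their brackets are vertical. -/
theorem fderiv_vertical {a : Fin p → ℝ} {b : Fin n → ℝ} {f : Fin n → Fin p → JetCoord p n → ℝ}
    (hf : ∀ j β, DifferentiableAt ℝ (f j β) u) (v : JetCoord p n) :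
    fderiv ℝ (fun w => ((a, b, fun j β => f j β w) : JetCoord p n)) u v =
      (0, 0, fun j β => fderiv ℝ (f j β) u v) := by
  have h : HasFDerivAt (fun w j β => f j β w)
      (ContinuousLinearMap.pi fun j => ContinuousLinearMap.pi fun β => fderiv ℝ (f j β) u) u :=
    hasFDerivAt_pi.2 fun j => hasFDerivAt_pi.2 fun β => (hf j β).hasFDerivAt
  have h2 := (hasFDerivAt_const a u).prodMk ((hasFDerivAt_const b u).prodMk h)
  rw [h2.fderiv]
  rfl

theorem fderiv_eq_sum (f : JetCoord p n → ℝ) (v : JetCoord p n) :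
    fderiv ℝ f u v = (∑ α, v.1 α * dT α f u) + (∑ i, v.2.1 i * dX i f u)
      + ∑ i, ∑ α, v.2.2 i α * dY i α f u := by
  have hv : v = (∑ α, v.1 α • ((Pi.single α 1, 0, 0) : JetCoord p n))
      + (∑ i, v.2.1 i • ((0, Pi.single i 1, 0) : JetCoord p n))
      + ∑ i, ∑ α, v.2.2 i α • ((0, 0, Pi.single i (Pi.single α 1)) : JetCoord p n) := by
    refine Prod.ext ?_ (Prod.ext ?_ ?_)
    · funext α
      simp [Prod.fst_sum, Finset.sum_apply, Pi.single_apply]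
    · funext i
      simp [Prod.fst_sum, Prod.snd_sum, Finset.sum_apply, Pi.single_apply]
    · funext j β
      have hV : ∀ x : Fin n, (∑ y : Fin p, v.2.2 x y *
          (Pi.single x (Pi.single y (1 : ℝ)) : Fin n → Fin p → ℝ) j β) =
            if j = x then v.2.2 x β else 0 := by
        intro x
        by_cases h : j = x
        · subst h; simp [Pi.single_apply]
        · simp [h]
      simp [Prod.snd_sum, Finset.sum_apply, hV]
  conv_lhs => rw [hv]
  simp only [map_add, map_sum, map_smul, smul_eq_mul]
  rfl

theorem fderiv_translate {f : JetCoord p n → ℝ} {a : JetCoord p n}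
    (h : ∀ᶠ w in nhds u, f (w + a) = f w) : fderiv ℝ f (u + a) = fderiv ℝ f u := by
  rw [← fderiv_comp_add_right a]
  exact Filter.EventuallyEq.fderiv_eq h

theorem fderiv_eq_zero_of_line {f : JetCoord p n → ℝ} {v : JetCoord p n}
    (hf : DifferentiableAt ℝ f u) (h : ∀ s : ℝ, f (u + s • v) = f u) : fderiv ℝ f u v = 0 := by
  rw [← hf.lineDeriv_eq_fderiv, lineDeriv]
  simp [h]

theorem fderiv_coord (i : Fin n) (α : Fin p) (v : JetCoord p n) :
    fderiv ℝ (fun w : JetCoord p n => w.2.2 i α) u v = v.2.2 i α := by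
  have h : (fun w : JetCoord p n => w.2.2 i α) = ((ContinuousLinearMap.proj (R := ℝ) α).comp
      ((ContinuousLinearMap.proj (R := ℝ) (φ := fun _ : Fin n => Fin p → ℝ) i).comp
        ((ContinuousLinearMap.snd ℝ (Fin n → ℝ) (Fin n → Fin p → ℝ)).comp
          (ContinuousLinearMap.snd ℝ (Fin p → ℝ) ((Fin n → ℝ) × (Fin n → Fin p → ℝ)))))) := rfl
  rw [h, ContinuousLinearMap.fderiv]
  rfl

end Jet

namespace LocalData

variable {p n : ℕ} {D : LocalData p n} {A : Set (Fin p → ℝ)} {B : Set (Fin n → ℝ)}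
  {u : JetCoord p n}

theorem deltaT_eq (α : Fin p) (f : JetCoord p n → ℝ) :
    D.deltaT α f u = dT α f u - ∑ k, ∑ η, D.M k η α u * dY k η f u := by
  rw [deltaT, fderiv_eq_sum]
  simp [eT, Pi.single_apply, sub_eq_add_neg]

namespace IsRegularOn

/-! ### The temporal Christoffel symbols -/

theorem fderiv_h_fst (R : D.IsRegularOn A B) (hu : u ∈ jetOver A B) (α β : Fin p) {v : JetCoord p n}
    (hv : v.1 = 0) : fderiv ℝ (fun w : JetCoord p n => D.h w.1 α β) u v = 0 :=
  fderiv_eq_zero_of_line (R.diffAt (R.smooth_h α β) hu) fun s => by simp [hv]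

theorem H_translate (γ α β : Fin p) {v : JetCoord p n} (hv : v.1 = 0) :
    D.H γ α β (u + v) = D.H γ α β u := by
  have h : ∀ α β, fderiv ℝ (fun w : JetCoord p n => D.h w.1 α β) (u + v) =
      fderiv ℝ (fun w : JetCoord p n => D.h w.1 α β) u := fun α β =>
    fderiv_translate (Filter.Eventually.of_forall fun w => by simp [hv])
  simp only [H, dT, h]
  simp [hv]

theorem fderiv_H_fst (R : D.IsRegularOn A B) (hu : u ∈ jetOver A B) (γ α β : Fin p)
    {v : JetCoord p n} (hv : v.1 = 0) : fderiv ℝ (D.H γ α β) u v = 0 :=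
  fderiv_eq_zero_of_line (R.diffAt (R.smooth_H γ α β) hu) fun s =>
    H_translate γ α β (by simp [hv])

theorem H_symm (R : D.IsRegularOn A B) (γ α β : Fin p) (u : JetCoord p n) :
    D.H γ α β u = D.H γ β α u := by
  simp only [H, fun w : JetCoord p n => R.h_symm w.1 α β]
  congr 1
  exact Finset.sum_congr rfl fun η _ => by ring

/-- Compatibility of the Levi-Civita connection of `h` with `h`, in the form that `∇ J = 0` needs.
-/
theorem dT_h (R : D.IsRegularOn A B) (hu : u ∈ jetOver A B) (η α β : Fin p) :
    dT η (fun w : JetCoord p n => D.h w.1 α β) u =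
      (∑ μ, D.h u.1 μ β * D.H μ α η u) + ∑ μ, D.h u.1 α μ * D.H μ β η u :=
  christoffel_metric (g := D.h u.1) (A := fun η α β => dT η (fun w : JetCoord p n => D.h w.1 α β) u)
    (Λ := fun γ α β => D.H γ α β u) (R.h_det _ hu.1) (R.h_symm _)
    (fun k i j => by simp only [fun w : JetCoord p n => R.h_symm w.1 i j])
    (fun l j k => by
      rw [R.H_symm, H]
      simp only [fun w : JetCoord p n => R.h_symm w.1 j k]) η α β

theorem fderiv_M (R : D.IsRegularOn A B) (hu : u ∈ jetOver A B) (i : Fin n) (α β : Fin p)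
    (v : JetCoord p n) : fderiv ℝ (D.M i α β) u v =
      -∑ γ, (D.H γ α β u * v.2.2 i γ + fderiv ℝ (D.H γ α β) u v * u.2.2 i γ) := by
  have hH : ∀ γ, DifferentiableAt ℝ (D.H γ α β) u := fun γ => R.diffAt (R.smooth_H γ α β) hu
  have hy : ∀ γ, DifferentiableAt ℝ (fun w : JetCoord p n => w.2.2 i γ) u :=
    fun γ => R.diffAt (smooth_y i γ) hu
  have h : D.M i α β = fun w => -∑ γ, D.H γ α β w * w.2.2 i γ := rfl
  rw [h, fderiv_neg_apply', fderiv_sum_apply' fun γ => (hH γ).fun_mul (hy γ)]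
  simp only [fderiv_mul_apply (hH _) (hy _), fderiv_coord]

/-- Only the factor `x^i_γ` of `M` varies along `δ/δx^j`, at rate `-N^{(i)}_{(γ)j}`. -/
theorem deltaX_M (R : D.IsRegularOn A B) (hu : u ∈ jetOver A B) (j : Fin n) (i : Fin n)
    (α β : Fin p) : D.deltaX j (D.M i α β) u = ∑ γ, D.H γ α β u * D.N i γ j u := by
  rw [deltaX, R.fderiv_M hu]
  simp only [R.fderiv_H_fst hu _ _ _ (v := D.eX j u) rfl]
  simp [eX]

/-- The derivative of `H` and the product `H H` that arises from `δx^i_γ/δt` are the two halves of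
the curvature of `h`. -/
theorem deltaT_M (R : D.IsRegularOn A B) (hu : u ∈ jetOver A B) (η : Fin p) (i : Fin n)
    (α β : Fin p) : D.deltaT η (D.M i α β) u =
      -∑ γ, (dT η (D.H γ α β) u + ∑ μ, D.H μ α β u * D.H γ μ η u) * u.2.2 i γ := by
  have hd : ∀ γ, fderiv ℝ (D.H γ α β) u (D.eT η u) = dT η (D.H γ α β) u := by
    intro γ
    rw [fderiv_eq_sum]
    have h : ∀ k μ, dY k μ (D.H γ α β) u = 0 := fun k μ => R.fderiv_H_fst hu _ _ _ rfl
    simp [eT, h, Pi.single_apply]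
  rw [deltaT, R.fderiv_M hu]
  simp only [hd]
  simp only [eT, M, neg_neg, add_mul, Finset.sum_add_distrib, Finset.mul_sum, Finset.sum_mul]
  rw [Finset.sum_comm, add_comm]
  simp only [mul_assoc]

/-! ## The coefficients of the Cartan connection in the adapted basis -/

variable {cov : ConnOp p n}

theorem cov_eX (R : D.IsRegularOn A B) (hc : D.IsGammaLinear (jetOver A B) cov)
    (hu : u ∈ jetOver A B) (i : Fin n) (v : JetCoord p n) :
    cov (D.eX i) u v =
      D.vec u 0 (fun m => D.coframe u (cov (D.eX i) u v) (.inr (.inl m))) 0 := by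
  have h := hc.parM (D.eX i) (R.smooth_eX i) u hu v
  simp only [projM_eX] at h
  exact h

/-- Up to the invertible matrix `h`, the vertical basis is the image under `J` of the horizontal
one. -/
theorem J_eT_eX (β : Fin p) (i : Fin n) (w : JetCoord p n) :
    D.J w (D.eT β w) (D.eX i w) = ∑ α, D.h w.1 α β • D.eV i α w := by
  rw [J, vec_vertical]
  refine Prod.ext ?_ (Prod.ext ?_ ?_)
  · simp [eV, Prod.fst_sum]
  · simp [eV, Prod.fst_sum, Prod.snd_sum]
  · funext j μ
    by_cases h : j = i
    · subst h
      simp [eV, eT, eX, Prod.snd_sum, Finset.sum_apply, Pi.single_apply]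
    · simp [eV, eT, eX, Prod.snd_sum, Finset.sum_apply, h]

/-- The covariant derivative of the vertical basis vectors, from `∇ J = 0`. -/
theorem cov_eV (R : D.IsRegularOn A B) (hc : D.IsHNormal (jetOver A B) cov)
    (hu : u ∈ jetOver A B) (v : JetCoord p n) (K : Fin p → Fin p → ℝ)
    (hK : ∀ β, cov (D.eT β) u v = ∑ μ, K μ β • D.eT μ u)
    (hh : ∀ α β, fderiv ℝ (fun w : JetCoord p n => D.h w.1 α β) u v =
      (∑ μ, D.h u.1 μ β * K μ α) + ∑ μ, D.h u.1 α μ * K μ β) (i : Fin n) (α : Fin p) :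
    cov (D.eV i α) u v = (0, 0, fun m μ =>
      (if μ = α then D.coframe u (cov (D.eX i) u v) (.inr (.inl m)) else 0)
        - if m = i then K α μ else 0) := by
  set c : Fin n → ℝ := fun m => D.coframe u (cov (D.eX i) u v) (.inr (.inl m)) with hcdef
  have hX : cov (D.eX i) u v = D.vec u 0 c 0 := R.cov_eX hc.toIsGammaLinear hu i v
  -- `∇ J = 0` evaluated on `δ/δt^β` and `δ/δx^i`, the left side expanded by the Leibniz rule.
  have hJ : ∀ β, ∑ α, (D.h u.1 α β • cov (D.eV i α) u v
      + fderiv ℝ (fun w : JetCoord p n => D.h w.1 α β) u v • D.eV i α u) =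
        (0, 0, fun m μ => (∑ η, D.h u.1 μ η * K η β) * (if m = i then 1 else 0)
          + D.h u.1 μ β * c m) := by
    intro β
    have h := hc.parJ (D.eT β) (D.eX i) (R.smooth_eT β) (R.smooth_eX i) u hu v
    simp only [J_eT_eX] at h
    have hs := hc.cov_sum hu (X := fun α => D.eV i α) (f := fun α w => D.h w.1 α β)
      (fun α => differentiableAt_const _) (fun α => R.diffAt (R.smooth_h α β) hu) v
    refine hs.symm.trans ?_
    rw [h, hK, hX, J, J, vec_vertical, vec_vertical, vec_eq]
    refine Prod.ext (by simp) (Prod.ext (by simp) ?_)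
    funext m μ
    simp [eT, eX, Prod.fst_sum, Finset.sum_apply, Pi.single_apply]
  -- Cancelling `h` is a statement about real vectors indexed by `α`, so the vector identity is
  -- tested against linear functionals; the coordinate functionals then recover it.
  have key : ∀ (ℓ : JetCoord p n →ₗ[ℝ] ℝ), (fun α => ℓ (cov (D.eV i α) u v)) = fun α =>
      ℓ (0, 0, fun m μ => (if μ = α then c m else 0) - if m = i then K α μ else 0) := by
    intro ℓ
    apply eq_of_sum_mul_eq (R.h_det _ hu.1)
    intro β
    have h1 : ∑ α, D.h u.1 β α • cov (D.eV i α) u v = ∑ α, D.h u.1 β α •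
        ((0, 0, fun m μ => (if μ = α then c m else 0) - if m = i then K α μ else 0) :
          JetCoord p n) := by
      have h2 := hJ β
      rw [Finset.sum_add_distrib] at h2
      simp only [R.h_symm _ β]
      rw [eq_sub_of_add_eq h2]
      refine Prod.ext ?_ (Prod.ext ?_ ?_)
      · simp [eV, Prod.fst_sum]
      · simp [eV, Prod.fst_sum, Prod.snd_sum]
      · funext m μ
        by_cases hm : m = i
        · subst hm
          simp [eV, Prod.snd_sum, Finset.sum_apply, hh, Pi.single_apply, mul_sub]
          ring
        · simp [eV, Prod.snd_sum, Finset.sum_apply, hm]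
    have h3 := congrArg ℓ h1
    simpa only [map_sum, map_smul, smul_eq_mul] using h3
  refine Prod.ext ?_ (Prod.ext ?_ ?_)
  · funext η
    exact congrFun (key ((LinearMap.proj η).comp (LinearMap.fst ℝ _ _))) α
  · funext m
    exact congrFun (key ((LinearMap.proj m).comp ((LinearMap.fst ℝ _ _).comp
      (LinearMap.snd ℝ _ _)))) α
  · funext m μ
    exact congrFun (key ((LinearMap.proj μ).comp ((LinearMap.proj (φ := fun _ => Fin p → ℝ) m).comp
      ((LinearMap.snd ℝ _ _).comp (LinearMap.snd ℝ _ _))))) α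

/-- In a direction without temporal component `h` is constant and `δ/δt` is parallel, so the
vertical vectors are transported like the `δ/δx^i`. -/
theorem cov_eV_of_eq_zero (R : D.IsRegularOn A B) (hc : D.IsHNormal (jetOver A B) cov)
    (hu : u ∈ jetOver A B) (v : JetCoord p n) (hv : v.1 = 0)
    (hT : ∀ β, cov (D.eT β) u v = 0) (i : Fin n) (α : Fin p) :
    cov (D.eV i α) u v = (0, 0, fun m μ =>
      if μ = α then D.coframe u (cov (D.eX i) u v) (.inr (.inl m)) else 0) := by
  rw [R.cov_eV hc hu v 0 (by simp [hT]) (fun α β => by simp [R.fderiv_h_fst hu α β hv])]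
  simp

theorem cov_eV_eT (R : D.IsRegularOn A B) (hc : D.IsHNormal (jetOver A B) cov)
    (hu : u ∈ jetOver A B) (i : Fin n) (α γ : Fin p) :
    cov (D.eV i α) u (D.eT γ u) = (0, 0, fun m μ =>
      (if μ = α then D.coefG cov m i γ u else 0) - if m = i then D.H α μ γ u else 0) := by
  refine R.cov_eV hc hu _ (fun μ β => D.H μ β γ u) (fun β => hc.barG u hu β γ) (fun α β => ?_) i α
  rw [← R.dT_h hu, fderiv_eq_sum]
  have h : ∀ k μ, dY k μ (fun w : JetCoord p n => D.h w.1 α β) u = 0 :=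
    fun k μ => R.fderiv_h_fst hu _ _ rfl
  simp [eT, h, Pi.single_apply]

end IsRegularOn

end LocalData

namespace LocalData

variable {p n : ℕ} {D : LocalData p n} {A : Set (Fin p → ℝ)} {B : Set (Fin n → ℝ)}
  {u : JetCoord p n}

/-! ## The torsion in the adapted basis -/

namespace IsRegularOn

variable {cov : ConnOp p n}

theorem fderiv_eT (R : D.IsRegularOn A B) (hu : u ∈ jetOver A B) (α : Fin p) (v : JetCoord p n) :
    fderiv ℝ (D.eT α) u v = (0, 0, fun m μ => -fderiv ℝ (D.M m μ α) u v) := by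
  have h := fderiv_vertical (a := Pi.single α (1 : ℝ)) (b := (0 : Fin n → ℝ))
    (fun m μ => (R.diffAt (R.smooth_M m μ α) hu).fun_neg) v
  simp only [fderiv_neg_apply'] at h
  exact h

theorem fderiv_eX (R : D.IsRegularOn A B) (hu : u ∈ jetOver A B) (i : Fin n) (v : JetCoord p n) :
    fderiv ℝ (D.eX i) u v = (0, 0, fun m μ => -fderiv ℝ (D.N m μ i) u v) := by
  have h := fderiv_vertical (a := (0 : Fin p → ℝ)) (b := Pi.single i (1 : ℝ))
    (fun m μ => (R.diffAt (R.smooth_N m μ i) hu).fun_neg) v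
  simp only [fderiv_neg_apply'] at h
  exact h

theorem fderiv_eV (D : LocalData p n) (i : Fin n) (α : Fin p) (v : JetCoord p n) :
    fderiv ℝ (D.eV i α) u v = 0 := by
  have h : D.eV i α = fun _ => D.eV i α u := rfl
  rw [h]
  simp

theorem torsion_eq (X Y : VF p n) : torsion cov X Y u =
    cov Y u (X u) - cov X u (Y u) - (fderiv ℝ Y u (X u) - fderiv ℝ X u (Y u)) := rfl

theorem torsion_self (X : VF p n) : torsion cov X X u = 0 := by
  simp [torsion]

theorem torsion_eT_eT (R : D.IsRegularOn A B) (hc : D.IsHNormal (jetOver A B) cov)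
    (hu : u ∈ jetOver A B) (α β : Fin p) :
    torsion cov (D.eT β) (D.eT α) u = D.vec u 0 0
      (fun m μ => D.deltaT β (D.M m μ α) u - D.deltaT α (D.M m μ β) u) := by
  rw [torsion_eq, hc.barG u hu, hc.barG u hu, R.fderiv_eT hu,
    R.fderiv_eT hu, vec_vertical]
  simp only [fun γ => R.H_symm γ α β u, sub_self, deltaT]
  refine Prod.ext (by simp) (Prod.ext (by simp) ?_)
  funext m μ
  simp
  ring

theorem torsion_eX_eT (R : D.IsRegularOn A B) (hc : D.IsHNormal (jetOver A B) cov)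
    (hu : u ∈ jetOver A B) (α : Fin p) (j : Fin n) :
    torsion cov (D.eX j) (D.eT α) u = D.vec u 0 (fun m => -D.coefG cov m j α u)
      (fun m μ => D.deltaX j (D.M m μ α) u - D.deltaT α (D.N m μ j) u) := by
  rw [torsion_eq, hc.barL u hu, R.cov_eX hc.toIsGammaLinear hu,
    R.fderiv_eT hu, R.fderiv_eX hu, vec_eq, vec_eq]
  refine Prod.ext (by simp) (Prod.ext ?_ ?_)
  · funext m
    simp [coefG]
  · funext m μ
    simp [coefG, deltaX, deltaT]
    ring

theorem torsion_eX_eX (R : D.IsRegularOn A B) (hc : D.IsCartan (jetOver A B) cov)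
    (hu : u ∈ jetOver A B) (i j : Fin n) :
    torsion cov (D.eX j) (D.eX i) u = D.vec u 0 0
      (fun m μ => D.deltaX j (D.N m μ i) u - D.deltaX i (D.N m μ j) u) := by
  have hs : cov (D.eX i) u (D.eX j u) = cov (D.eX j) u (D.eX i u) := by
    rw [R.cov_eX hc.toIsGammaLinear hu i, R.cov_eX hc.toIsGammaLinear hu j]
    congr 1
    funext m
    exact hc.symmL u hu m i j
  rw [torsion_eq, hs, R.fderiv_eX hu, R.fderiv_eX hu, vec_vertical]
  refine Prod.ext (by simp) (Prod.ext (by simp) ?_)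
  funext m μ
  simp [deltaX]
  ring

theorem torsion_eV_eT (R : D.IsRegularOn A B) (hc : D.IsHNormal (jetOver A B) cov)
    (hu : u ∈ jetOver A B) (α β : Fin p) (j : Fin n) :
    torsion cov (D.eV j β) (D.eT α) u = D.vec u 0 0
      (fun m μ => -(if μ = β then 1 else 0) * D.coefG cov m j α u) := by
  rw [torsion_eq, hc.barC u hu, R.cov_eV_eT hc hu, R.fderiv_eT hu,
    fderiv_eV, vec_vertical]
  refine Prod.ext (by simp) (Prod.ext (by simp) ?_)
  funext m μ
  -- This bracket term cancels the `H` term in `∇_{δ/δt^α} ∂/∂x^j_β`, leaving only `G`.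
  have hM : fderiv ℝ (D.M m μ α) u (D.eV j β u) = -if m = j then D.H β μ α u else 0 := by
    rw [R.fderiv_M hu]
    simp only [R.fderiv_H_fst hu _ _ _ (v := D.eV j β u) rfl]
    by_cases h : m = j
    · subst h; simp [eV, Pi.single_apply]
    · simp [eV, h]
  simp [hM]

theorem torsion_eV_eX (R : D.IsRegularOn A B) (hc : D.IsHNormal (jetOver A B) cov)
    (hu : u ∈ jetOver A B) (β : Fin p) (i j : Fin n) :
    torsion cov (D.eV j β) (D.eX i) u = D.vec u 0 (fun m => D.coefC cov m i j β u)
      (fun m μ => dY j β (D.N m μ i) u - if μ = β then D.coefL cov m j i u else 0) := by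
  rw [torsion_eq, R.cov_eX hc.toIsGammaLinear hu,
    R.cov_eV_of_eq_zero hc hu _ rfl (fun β => hc.barL u hu β i), R.fderiv_eX hu, fderiv_eV,
    vec_eq, vec_eq]
  refine Prod.ext (by simp) (Prod.ext ?_ ?_)
  · funext m
    simp [coefC]
  · funext m μ
    simp [coefC, coefL, dY, eV]
    ring

theorem torsion_eV_eV (R : D.IsRegularOn A B) (hc : D.IsHNormal (jetOver A B) cov)
    (hu : u ∈ jetOver A B) (α β : Fin p) (i j : Fin n) :
    torsion cov (D.eV j β) (D.eV i α) u = D.vec u 0 0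
      (fun m μ => (if μ = α then D.coefC cov m i j β u else 0)
        - if μ = β then D.coefC cov m j i α u else 0) := by
  rw [torsion_eq,
    R.cov_eV_of_eq_zero hc hu _ rfl (fun γ => hc.barC u hu γ j β),
    R.cov_eV_of_eq_zero hc hu _ rfl (fun γ => hc.barC u hu γ i α), fderiv_eV, fderiv_eV,
    vec_vertical]
  refine Prod.ext (by simp) (Prod.ext (by simp) ?_)
  funext m μ
  simp [coefC]

/-- The torsion components for one temporal variable. -/
theorem torsion_one_time (R : D.IsRegularOn A B) (hc : D.IsCartan (jetOver A B) cov)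
    (hp : p = 1) (hu : u ∈ jetOver A B) (o : Fin p) (i j : Fin n) :
    torsion cov (D.eT o) (D.eT o) u = 0 ∧
      torsion cov (D.eX j) (D.eT o) u = D.vec u 0
        (fun m => -D.coefG cov m j o u)
        (fun m _ => -dT o (D.N m o j) u
          + D.H o o o u * (D.N m o j u - ∑ k, dY k o (D.N m o j) u * u.2.2 k o)) ∧
      torsion cov (D.eX j) (D.eX i) u = D.vec u 0 0
        (fun m _ => D.deltaX j (D.N m o i) u - D.deltaX i (D.N m o j) u) ∧
      torsion cov (D.eV j o) (D.eT o) u = D.vec u 0 0 (fun m _ => -D.coefG cov m j o u) ∧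
      torsion cov (D.eV j o) (D.eX i) u = D.vec u 0
        (fun m => D.coefC cov m i j o u)
        (fun m _ => dY j o (D.N m o i) u - D.coefL cov m j i u) ∧
      torsion cov (D.eV j o) (D.eV i o) u = 0 := by
  have ho : ∀ μ : Fin p, μ = o := by
    subst hp
    exact fun μ => Subsingleton.elim _ _
  have hsum : ∀ f : Fin p → ℝ, ∑ μ, f μ = f o := fun f =>
    Fintype.sum_eq_single o fun μ hμ => absurd (ho μ) hμ
  have hn := hc.toIsHNormal
  refine ⟨torsion_self _, ?_, ?_, ?_, ?_, ?_⟩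
  · rw [R.torsion_eX_eT hn hu]
    congr 1
    funext m μ
    -- With one time `δM/δx = H N` and `δN/δt = ∂N/∂t + H y ∂N/∂y`; their difference is the claim.
    rw [ho μ, R.deltaX_M hu, deltaT_eq]
    simp only [hsum, M]
    rw [mul_sub, Finset.mul_sum]
    simp only [neg_mul, Finset.sum_neg_distrib, mul_assoc, mul_comm (u.2.2 _ _)]
    ring
  · rw [R.torsion_eX_eX hc hu]
    congr 1
    funext m μ
    rw [ho μ]
  · rw [R.torsion_eV_eT hn hu]
    congr 1
    funext m μ
    simp [ho μ]
  · rw [R.torsion_eV_eX hn hu]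
    congr 1
    funext m μ
    simp [ho μ]
  · rw [R.torsion_eV_eV hn hu, vec_vertical]
    simp only [fun m => hc.symmC u hu m j i, sub_self]
    rfl

end IsRegularOn

end LocalData

/-! ### Polynomial dependence along the fibres. -/

theorem matrix_inv_symm {m : ℕ} {g : Matrix (Fin m) (Fin m) ℝ} (hs : ∀ i j, g i j = g j i)
    (i j : Fin m) : g⁻¹ i j = g⁻¹ j i := by
  have h : g.transpose = g := Matrix.ext fun i j => hs j i
  have h2 := Matrix.transpose_nonsing_inv g
  rw [h] at h2
  exact congrFun (congrFun h2 j) i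

namespace LocalData

variable {p n : ℕ} {D : LocalData p n} {A : Set (Fin p → ℝ)} {B : Set (Fin n → ℝ)}
  {u : JetCoord p n}

theorem add_vertical (u : JetCoord p n) (c : Fin n → Fin p → ℝ) :
    u + (0, 0, c) = (u.1, u.2.1, u.2.2 + c) := by
  refine Prod.ext ?_ (Prod.ext ?_ rfl) <;> simp

/-- A function that is quadratic along the line through `(t, x, 0)` and `(t, x, y)`. -/
theorem eq_of_quadratic_line {f : JetCoord p n → ℝ} {a b : ℝ}
    (hf : ∀ s : ℝ, DifferentiableAt ℝ f (u.1, u.2.1, s • u.2.2))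
    (hd : ∀ s : ℝ, fderiv ℝ f (u.1, u.2.1, s • u.2.2) (0, 0, u.2.2) = a + 2 * s * b) :
    f u = f (u.1, u.2.1, 0) + a + b := by
  have hline : ∀ s : ℝ, HasDerivAt (fun s : ℝ => ((u.1, u.2.1, s • u.2.2) : JetCoord p n))
      (0, 0, u.2.2) s := by
    intro s
    have h := (hasDerivAt_id s).smul_const u.2.2
    simp only [id, one_smul] at h
    exact (hasDerivAt_const s u.1).prodMk ((hasDerivAt_const s u.2.1).prodMk h)
  -- After subtraction of the expected quadratic polynomial the derivative in `s` vanishes; then `s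
  -- = 1` is compared with `s = 0`.
  have hψ : ∀ s : ℝ, HasDerivAt
      (fun s : ℝ => f (u.1, u.2.1, s • u.2.2) - (a * s + b * s ^ 2)) 0 s := by
    intro s
    have h1 := (hf s).hasFDerivAt.comp_hasDerivAt s (hline s)
    rw [hd s] at h1
    have h2 : HasDerivAt (fun s : ℝ => a * s + b * s ^ 2) (a + 2 * s * b) s :=
      (((hasDerivAt_id s).const_mul a).fun_add (((hasDerivAt_id s).fun_pow 2).const_mul b)).congr_deriv
        (by simp only [id]; push_cast; ring)
    exact (h1.fun_sub h2).congr_deriv (sub_self _)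
  have hc := is_const_of_deriv_eq_zero (fun s => (hψ s).differentiableAt)
    (fun s => (hψ s).deriv) 1 0
  simp only [one_smul, zero_smul] at hc
  have hu : ((u.1, u.2.1, u.2.2) : JetCoord p n) = u := rfl
  rw [hu] at hc
  linarith

theorem eq_of_affine_line {f : JetCoord p n → ℝ} {c : Fin n → Fin p → ℝ}
    (hf : ∀ y, DifferentiableAt ℝ f (u.1, u.2.1, y))
    (hd : ∀ y j β, dY j β f (u.1, u.2.1, y) = c j β) :
    f u = f (u.1, u.2.1, 0) + ∑ j, ∑ β, c j β * u.2.2 j β := by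
  rw [eq_of_quadratic_line (f := f) (a := ∑ j, ∑ β, c j β * u.2.2 j β) (b := 0) (fun s => hf _) ?_]
  · ring
  · intro s
    rw [fderiv_eq_sum]
    simp [hd, mul_comm]

/-! ## Functions that do not depend on the fibre coordinates -/

/-- On the given set, `f` depends on `(t, x)` only. -/
def FibreConst (W : Set (JetCoord p n)) (f : JetCoord p n → ℝ) : Prop :=
  ∀ u ∈ W, ∀ c : Fin n → Fin p → ℝ, f (u + (0, 0, c)) = f u

namespace IsRegularOn

theorem fibreConst_fderiv (R : D.IsRegularOn A B) {f : JetCoord p n → ℝ}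
    (hf : FibreConst (jetOver A B) f) (v : JetCoord p n) :
    FibreConst (jetOver A B) fun w => fderiv ℝ f w v := by
  intro u hu c
  exact congrArg (fun l => l v)
    (fderiv_translate (Filter.eventually_of_mem (R.isOpen.mem_nhds hu) fun w hw => hf w hw c))

theorem fderiv_eq_zero_of_fibreConst (R : D.IsRegularOn A B) {f : JetCoord p n → ℝ}
    (hs : ContDiffOn ℝ ∞ f (jetOver A B)) (hf : FibreConst (jetOver A B) f) (hu : u ∈ jetOver A B)
    (c : Fin n → Fin p → ℝ) : fderiv ℝ f u (0, 0, c) = 0 := by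
  refine fderiv_eq_zero_of_line (R.diffAt hs hu) fun s => ?_
  have h := hf u hu (s • c)
  simpa using h

/-- On functions of `(t, x)` the adapted derivatives therefore agree with the partial ones. -/
theorem fderiv_of_fibreConst (R : D.IsRegularOn A B) {f : JetCoord p n → ℝ}
    (hs : ContDiffOn ℝ ∞ f (jetOver A B)) (hf : FibreConst (jetOver A B) f) (hu : u ∈ jetOver A B)
    (v : JetCoord p n) : fderiv ℝ f u v = fderiv ℝ f u (v.1, v.2.1, 0) := by
  have h : v = (v.1, v.2.1, 0) + (0, 0, v.2.2) := by
    refine Prod.ext ?_ (Prod.ext ?_ ?_) <;> simp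
  conv_lhs => rw [h]
  rw [map_add, R.fderiv_eq_zero_of_fibreConst hs hf hu, add_zero]

theorem fibreConst_h (α β : Fin p) :
    FibreConst (jetOver A B) fun u : JetCoord p n => D.h u.1 α β := by
  intro u _ c
  rw [add_vertical]

theorem fibreConst_hinv (α β : Fin p) :
    FibreConst (jetOver A B) fun u : JetCoord p n => (D.h u.1)⁻¹ α β := by
  intro u _ c
  rw [add_vertical]

theorem fibreConst_U (i : Fin n) (α : Fin p) : FibreConst (jetOver A B) (D.U i α) := by
  intro u _ c
  rw [add_vertical, U, U]

theorem smooth_U (R : D.IsRegularOn A B) (i : Fin n) (α : Fin p) :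
    ContDiffOn ℝ ∞ (D.U i α) (jetOver A B) := by
  have h : ContDiffOn ℝ ∞ (fun u : JetCoord p n => ((u.1, u.2.1, 0) : JetCoord p n))
      (jetOver A B) := by fun_prop
  exact (R.smooth_dY R.L_smooth i α).comp h fun u hu => hu

theorem smooth_curlU (R : D.IsRegularOn A B) (i : Fin n) (α : Fin p) (j : Fin n) :
    ContDiffOn ℝ ∞ (D.curlU i α j) (jetOver A B) :=
  (R.smooth_dX (R.smooth_U i α) j).sub (R.smooth_dX (R.smooth_U j α) i)

theorem smooth_F (R : D.IsRegularOn A B) (m i : Fin n) (μ : Fin p) :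
    ContDiffOn ℝ ∞ (D.F m i μ) (jetOver A B) :=
  ContDiffOn.sum fun k _ => ((R.smooth_ginv m k).div_const 2).mul
    ((R.smooth_dT (R.g_smooth k i) μ).add (contDiffOn_const.mul (ContDiffOn.sum fun β _ =>
      (R.smooth_h μ β).mul (R.smooth_curlU k β i))))

/-! ## Several times: the metric and the Lagrangian -/

theorem dY_dY_L (R : D.IsRegularOn A B) (hu : u ∈ jetOver A B) (i : Fin n) (α : Fin p) (j : Fin n)
    (β : Fin p) : dY i α (dY j β D.L) u = 2 * ((D.h u.1)⁻¹ α β * D.g u i j) := by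
  rw [← R.hess u hu, vertHess]
  ring

/-- The Kronecker form of the Hessian clashes with the symmetry of third derivatives: exchanging
`(k, γ)` and `(i, α)` moves the temporal index from one factor to the other. -/
theorem dY_g (R : D.IsRegularOn A B) (hp : 2 ≤ p) (hu : u ∈ jetOver A B) (k : Fin n) (γ : Fin p)
    (i j : Fin n) : dY k γ (fun w => D.g w i j) u = 0 := by
  have third : ∀ (k : Fin n) (γ : Fin p) (i : Fin n) (α β : Fin p),
      dY k γ (dY i α (dY j β D.L)) u = 2 * ((D.h u.1)⁻¹ α β * dY k γ (fun w => D.g w i j) u) := by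
    intro k γ i α β
    rw [dY, fderiv_congr_on R.isOpen (fun w hw => R.dY_dY_L hw i α j β) hu,
      fderiv_const_mul_apply ((R.diffAt (R.smooth_hinv α β) hu).fun_mul
        (R.diffAt (R.g_smooth i j) hu)), fderiv_mul_apply (R.diffAt (R.smooth_hinv α β) hu)
        (R.diffAt (R.g_smooth i j) hu),
      R.fderiv_eq_zero_of_fibreConst (R.smooth_hinv α β) (fibreConst_hinv α β) hu]
    simp [dY]
  have swap : ∀ α β, (D.h u.1)⁻¹ α β * dY k γ (fun w => D.g w i j) u =
      (D.h u.1)⁻¹ γ β * dY i α (fun w => D.g w k j) u := by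
    intro α β
    have h := fderiv_comm R.isOpen (R.smooth_dY R.L_smooth j β) hu
      (0, 0, Pi.single i (Pi.single α 1)) (0, 0, Pi.single k (Pi.single γ 1))
    have h2 := (third k γ i α β).symm.trans (h.trans (third i α k γ β))
    linarith
  -- A second time provides `α ≠ γ`. Contraction of `swap` with `h_{βα}` turns the coefficient on
  -- the left into `δ^α_α = 1` and the one on the right into `δ^γ_α = 0`.
  have : Nontrivial (Fin p) := Fin.nontrivial_iff_two_le.2 hp
  obtain ⟨α, hα⟩ := exists_ne γ
  have hinv : ∀ a b, ∑ β, (D.h u.1)⁻¹ a β * D.h u.1 β b = (1 : Matrix (Fin p) (Fin p) ℝ) a b := by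
    intro a b
    rw [← Matrix.nonsing_inv_mul _ (isUnit_iff_ne_zero.2 (R.h_det u.1 hu.1)), Matrix.mul_apply]
  have h1 : (∑ β, (D.h u.1)⁻¹ α β * D.h u.1 β α) * dY k γ (fun w => D.g w i j) u =
      (∑ β, (D.h u.1)⁻¹ γ β * D.h u.1 β α) * dY i α (fun w => D.g w k j) u := by
    rw [Finset.sum_mul, Finset.sum_mul]
    exact Finset.sum_congr rfl fun β _ => by linear_combination D.h u.1 β α * swap α β
  rw [hinv, hinv, Matrix.one_apply_eq, Matrix.one_apply_ne hα.symm] at h1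
  simpa using h1

theorem g_fibre (R : D.IsRegularOn A B) (hp : 2 ≤ p) (hu : u ∈ jetOver A B)
    (y : Fin n → Fin p → ℝ) : D.g (u.1, u.2.1, y) = D.g u := by
  have h : ∀ w ∈ jetOver A B, ∀ i j, D.g w i j = D.g (w.1, w.2.1, 0) i j := by
    intro w hw i j
    have h := eq_of_affine_line (u := w) (f := fun w => D.g w i j) (c := 0)
      (fun y => R.diffAt (R.g_smooth i j) hw) 
      (fun y k γ => R.dY_g hp (u := (w.1, w.2.1, y)) hw k γ i j)
    simpa using h
  ext i j
  rw [h u hu, h (u.1, u.2.1, y) hu]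

theorem fibreConst_g (R : D.IsRegularOn A B) (hp : 2 ≤ p) (i j : Fin n) :
    FibreConst (jetOver A B) fun w => D.g w i j := by
  intro u hu c
  simp only [add_vertical, R.g_fibre hp hu]

theorem fibreConst_ginv (R : D.IsRegularOn A B) (hp : 2 ≤ p) (i j : Fin n) :
    FibreConst (jetOver A B) fun w => (D.g w)⁻¹ i j := by
  intro u hu c
  simp only [add_vertical, R.g_fibre hp hu]

theorem fibreConst_Gam (R : D.IsRegularOn A B) (hp : 2 ≤ p) (l j k : Fin n) :
    FibreConst (jetOver A B) (D.Gam l j k) := by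
  intro u hu c
  have h1 := fun i => R.fibreConst_ginv hp l i u hu c
  have h2 := fun k i j => R.fibreConst_fderiv (R.fibreConst_g hp i j) (0, Pi.single k 1, 0) u hu c
  simp only at h1 h2
  simp only [Gam, dX, h1, h2]

theorem fibreConst_F (R : D.IsRegularOn A B) (hp : 2 ≤ p) (m i : Fin n) (μ : Fin p) :
    FibreConst (jetOver A B) (D.F m i μ) := by
  intro u hu c
  have h1 := fun k => R.fibreConst_ginv hp m k u hu c
  have h2 := fun k i => R.fibreConst_fderiv (R.fibreConst_g hp k i) (Pi.single μ 1, 0, 0) u hu c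
  have h3 := fun k i β => R.fibreConst_fderiv (fibreConst_U (D := D) i β) (0, Pi.single k 1, 0) u hu c
  have h4 := fun β => fibreConst_h (D := D) μ β u hu c
  simp only at h1 h2 h3 h4
  simp only [F, curlU, dT, dX, h1, h2, h3, h4]

/-- The vertical Hessian is now constant on each fibre, so the gradient is affine there; a second
integration gives `L_eq`. -/
theorem dY_L (R : D.IsRegularOn A B) (hp : 2 ≤ p) (hu : u ∈ jetOver A B) (i : Fin n) (α : Fin p) :
    dY i α D.L u =
      D.U i α u + ∑ j, ∑ β, 2 * ((D.h u.1)⁻¹ α β * D.g u i j) * u.2.2 j β := by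
  refine eq_of_affine_line (f := dY i α D.L) (fun y => R.diffAt (R.smooth_dY R.L_smooth i α) hu) ?_
  intro y j β
  rw [R.dY_dY_L (u := (u.1, u.2.1, y)) hu, R.g_fibre hp hu, R.g_symm u j i,
    matrix_inv_symm (R.h_symm u.1) β α]

theorem L_eq (R : D.IsRegularOn A B) (hp : 2 ≤ p) (hu : u ∈ jetOver A B) :
    D.L u = (∑ i, ∑ j, ∑ α, ∑ β, (D.h u.1)⁻¹ α β * D.g u i j * u.2.2 i α * u.2.2 j β)
        + (∑ i, ∑ α, D.U i α u * u.2.2 i α) + D.pot u := by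
  have hQ : ∑ i, ∑ j, ∑ α, ∑ β, (D.h u.1)⁻¹ α β * D.g u i j * u.2.2 i α * u.2.2 j β =
      ∑ i, ∑ α, u.2.2 i α * ∑ j, ∑ β, (D.h u.1)⁻¹ α β * D.g u i j * u.2.2 j β := by
    refine Finset.sum_congr rfl fun i _ => ?_
    rw [Finset.sum_comm]
    refine Finset.sum_congr rfl fun α _ => ?_
    simp only [Finset.mul_sum]
    exact Finset.sum_congr rfl fun j _ => Finset.sum_congr rfl fun β _ => by ring
  rw [hQ, eq_of_quadratic_line (u := u) (f := D.L) (a := ∑ i, ∑ α, D.U i α u * u.2.2 i α)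
    (b := ∑ i, ∑ α, u.2.2 i α * ∑ j, ∑ β, (D.h u.1)⁻¹ α β * D.g u i j * u.2.2 j β)
    (fun s => R.diffAt R.L_smooth hu) ?_, pot]
  · ring
  · intro s
    have hw : ((u.1, u.2.1, s • u.2.2) : JetCoord p n) ∈ jetOver A B := hu
    rw [fderiv_eq_sum]
    simp only [R.dY_L hp hw, R.g_fibre hp hu, Pi.zero_apply, zero_mul, Finset.sum_const_zero,
      zero_add, Finset.mul_sum, ← Finset.sum_add_distrib]
    refine Finset.sum_congr rfl fun i _ => Finset.sum_congr rfl fun α _ => ?_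
    rw [mul_add, mul_comm (D.U i α u), Finset.mul_sum]
    congr 1
    refine Finset.sum_congr rfl fun j _ => ?_
    rw [Finset.mul_sum]
    refine Finset.sum_congr rfl fun β _ => ?_
    simp only [Pi.smul_apply, smul_eq_mul]
    ring

/-! ## Several times: the spatial nonlinear connection -/

theorem dT_hinv (R : D.IsRegularOn A B) (hu : u ∈ jetOver A B) (η α β : Fin p) :
    dT η (fun w : JetCoord p n => (D.h w.1)⁻¹ α β) u =
      -(∑ μ, (D.h u.1)⁻¹ α μ * D.H β μ η u) - ∑ μ, (D.h u.1)⁻¹ β μ * D.H α μ η u := by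
  have hdet := R.h_det u.1 hu.1
  -- As an equality of vectors indexed by `β`, the claim may be checked after contraction with `h`,
  -- where it follows by differentiating `h⁻¹ h = 1`.
  revert β
  refine congrFun (f := fun β => dT η (fun w : JetCoord p n => (D.h w.1)⁻¹ α β) u)
    (eq_of_sum_mul_eq hdet fun γ => ?_)
  have hconst : ∀ w ∈ jetOver A B, ∑ β, (D.h w.1)⁻¹ α β * D.h w.1 β γ =
      (1 : Matrix (Fin p) (Fin p) ℝ) α γ := by
    intro w hw
    rw [← Matrix.nonsing_inv_mul _ (isUnit_iff_ne_zero.2 (R.h_det w.1 hw.1)), Matrix.mul_apply]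
  have hd := fderiv_congr_on R.isOpen hconst hu (Pi.single η 1, 0, 0)
  rw [fderiv_sum_apply' fun β => (R.diffAt (R.smooth_hinv α β) hu).fun_mul
    (R.diffAt (R.smooth_h β γ) hu)] at hd
  simp only [fderiv_mul_apply (R.diffAt (R.smooth_hinv α _) hu) (R.diffAt (R.smooth_h _ γ) hu),
    fderiv_fun_const, Pi.zero_apply, zero_apply, Finset.sum_add_distrib] at hd
  have h1 : ∑ β, D.h u.1 γ β * dT η (fun w : JetCoord p n => (D.h w.1)⁻¹ α β) u =
      -∑ β, (D.h u.1)⁻¹ α β * dT η (fun w : JetCoord p n => D.h w.1 β γ) u := by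
    rw [eq_neg_iff_add_eq_zero, add_comm, ← hd]
    simp only [R.h_symm u.1 γ, mul_comm, dT]
  rw [h1]
  simp only [R.dT_h hu, mul_add, mul_sub, mul_neg, Finset.sum_add_distrib, Finset.sum_sub_distrib,
    Finset.sum_neg_distrib]
  rw [sum_inv_mul_sum_mul hdet (fun μ => D.H μ γ η u), sum_mul_sum_inv_mul hdet
    (fun μ => D.H α μ η u)]
  simp only [Finset.mul_sum]
  rw [Finset.sum_comm]
  simp only [R.h_symm u.1 γ, mul_left_comm]
  ring

/-- The contraction of `∇ h⁻¹ = 0`; it removes every explicit `H` from the vertical derivative of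
the spray. -/
theorem trace_dT_hinv (R : D.IsRegularOn A B) (hu : u ∈ jetOver A B) (γ : Fin p) :
    (∑ α, dT α (fun w : JetCoord p n => (D.h w.1)⁻¹ γ α) u)
      + (∑ α, ∑ μ, (D.h u.1)⁻¹ γ α * D.H μ α μ u)
      + ∑ α, ∑ β, (D.h u.1)⁻¹ α β * D.H γ α β u = 0 := by
  simp only [R.dT_hinv hu, Finset.sum_sub_distrib, Finset.sum_neg_distrib]
  rw [Finset.sum_comm (f := fun α μ => (D.h u.1)⁻¹ γ μ * D.H α μ α u)]
  simp only [R.H_symm γ _ _ u]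
  ring

theorem dX_dY_L (R : D.IsRegularOn A B) (hp : 2 ≤ p) (hu : u ∈ jetOver A B) (l i : Fin n)
    (α : Fin p) : dX l (dY i α D.L) u =
      dX l (D.U i α) u
        + ∑ j, ∑ β, 2 * ((D.h u.1)⁻¹ α β * dX l (fun w => D.g w i j) u) * u.2.2 j β := by
  have hg : ∀ j, DifferentiableAt ℝ (fun w => D.g w i j) u := fun j => R.diffAt (R.g_smooth i j) hu
  have hh : ∀ β, DifferentiableAt ℝ (fun w : JetCoord p n => (D.h w.1)⁻¹ α β) u :=
    fun β => R.diffAt (R.smooth_hinv α β) hu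
  have hy : ∀ j β, DifferentiableAt ℝ (fun w : JetCoord p n => w.2.2 j β) u :=
    fun j β => R.diffAt (smooth_y j β) hu
  have hterm : ∀ j β, DifferentiableAt ℝ
      (fun w : JetCoord p n => 2 * ((D.h w.1)⁻¹ α β * D.g w i j) * w.2.2 j β) u :=
    fun j β => (((hh β).fun_mul (hg j)).const_mul 2).fun_mul (hy j β)
  have hh0 : ∀ β, fderiv ℝ (fun w : JetCoord p n => (D.h w.1)⁻¹ α β) u (0, Pi.single l 1, 0) = 0 :=
    fun β => fderiv_eq_zero_of_line (hh β) fun s => by simp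
  rw [dX, fderiv_congr_on R.isOpen (fun w hw => R.dY_L hp hw i α) hu,
    fderiv_add_apply' (R.diffAt (R.smooth_U i α) hu)
      (DifferentiableAt.fun_sum fun j _ => DifferentiableAt.fun_sum fun β _ => hterm j β),
    fderiv_sum_apply' fun j => DifferentiableAt.fun_sum fun β _ => hterm j β, dX]
  congr 1
  refine Finset.sum_congr rfl fun j _ => ?_
  rw [fderiv_sum_apply' fun β => hterm j β]
  refine Finset.sum_congr rfl fun β _ => ?_
  rw [fderiv_mul_apply (((hh β).fun_mul (hg j)).const_mul 2) (hy j β),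
    fderiv_const_mul_apply ((hh β).fun_mul (hg j)), fderiv_mul_apply (hh β) (hg j), hh0,
    fderiv_coord, dX]
  simp

/-- Commuting the derivatives produces the vertical Hessian, whose factor `h⁻¹` does not depend on
`x`. -/
theorem dY_dX_dY_L (R : D.IsRegularOn A B) (hu : u ∈ jetOver A B) (l i j : Fin n) (α γ : Fin p) :
    dY l γ (dX j (dY i α D.L)) u =
      2 * ((D.h u.1)⁻¹ γ α * dX j (fun w => D.g w l i) u) := by
  have hh0 : fderiv ℝ (fun w : JetCoord p n => (D.h w.1)⁻¹ γ α) u (0, Pi.single j 1, 0) = 0 :=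
    fderiv_eq_zero_of_line (R.diffAt (R.smooth_hinv γ α) hu) fun s => by simp
  have h := fderiv_comm R.isOpen (R.smooth_dY R.L_smooth i α) hu (0, Pi.single j 1, 0)
    (0, 0, Pi.single l (Pi.single γ 1))
  refine h.trans ?_
  have h2 := fderiv_congr_on R.isOpen (fun w hw => R.dY_dY_L hw l γ i α) hu (0, Pi.single j 1, 0)
  refine h2.trans ?_
  rw [fderiv_const_mul_apply ((R.diffAt (R.smooth_hinv γ α) hu).fun_mul
    (R.diffAt (R.g_smooth l i) hu)), fderiv_mul_apply (R.diffAt (R.smooth_hinv γ α) hu)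
    (R.diffAt (R.g_smooth l i) hu), hh0, dX]
  simp

theorem dY_dT_dY_L (R : D.IsRegularOn A B) (hu : u ∈ jetOver A B) (l i : Fin n) (α γ : Fin p) :
    dY l γ (dT α (dY i α D.L)) u =
      2 * ((D.h u.1)⁻¹ γ α * dT α (fun w => D.g w l i) u
        + dT α (fun w : JetCoord p n => (D.h w.1)⁻¹ γ α) u * D.g u l i) := by
  have h := fderiv_comm R.isOpen (R.smooth_dY R.L_smooth i α) hu (Pi.single α 1, 0, 0)
    (0, 0, Pi.single l (Pi.single γ 1))
  refine h.trans ?_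
  have h2 := fderiv_congr_on R.isOpen (fun w hw => R.dY_dY_L hw l γ i α) hu (Pi.single α 1, 0, 0)
  refine h2.trans ?_
  rw [fderiv_const_mul_apply ((R.diffAt (R.smooth_hinv γ α) hu).fun_mul
    (R.diffAt (R.g_smooth l i) hu)), fderiv_mul_apply (R.diffAt (R.smooth_hinv γ α) hu)
    (R.diffAt (R.g_smooth l i) hu)]
  rfl

/-- The expression in the braces of the definition of the spray. -/
noncomputable def eulerBrace (D : LocalData p n) (i : Fin n) (u : JetCoord p n) : ℝ :=
  (∑ j, ∑ α, dX j (dY i α D.L) u * u.2.2 j α) - dX i D.L u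
      + (∑ α, dT α (dY i α D.L) u)
      + (∑ α, ∑ γ, dY i α D.L u * D.H γ α γ u)
      + 2 * ∑ j, D.g u i j * ∑ α, ∑ β, ∑ γ, (D.h u.1)⁻¹ α β * D.H γ α β u * u.2.2 j γ

theorem smooth_dX_dY_L_sum (R : D.IsRegularOn A B) (i : Fin n) : ContDiffOn ℝ ∞
    (fun u => ∑ j, ∑ α, dX j (dY i α D.L) u * u.2.2 j α) (jetOver A B) :=
  ContDiffOn.sum fun j _ => ContDiffOn.sum fun α _ =>
    (R.smooth_dX (R.smooth_dY R.L_smooth i α) j).mul (smooth_y j α)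

theorem smooth_dT_dY_L_sum (R : D.IsRegularOn A B) (i : Fin n) : ContDiffOn ℝ ∞
    (fun u => ∑ α, dT α (dY i α D.L) u) (jetOver A B) :=
  ContDiffOn.sum fun α _ => R.smooth_dT (R.smooth_dY R.L_smooth i α) α

theorem smooth_dY_L_H_sum (R : D.IsRegularOn A B) (i : Fin n) : ContDiffOn ℝ ∞
    (fun u => ∑ α, ∑ γ, dY i α D.L u * D.H γ α γ u) (jetOver A B) :=
  ContDiffOn.sum fun α _ => ContDiffOn.sum fun γ _ =>
    (R.smooth_dY R.L_smooth i α).mul (R.smooth_H γ α γ)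

theorem smooth_hinv_H_sum (R : D.IsRegularOn A B) (j : Fin n) : ContDiffOn ℝ ∞
    (fun u => ∑ α, ∑ β, ∑ γ, (D.h u.1)⁻¹ α β * D.H γ α β u * u.2.2 j γ) (jetOver A B) :=
  ContDiffOn.sum fun α _ => ContDiffOn.sum fun β _ => ContDiffOn.sum fun γ _ =>
    ((R.smooth_hinv α β).mul (R.smooth_H γ α β)).mul (smooth_y j γ)

theorem smooth_g_H_sum (R : D.IsRegularOn A B) (i : Fin n) : ContDiffOn ℝ ∞
    (fun u => ∑ j, D.g u i j * ∑ α, ∑ β, ∑ γ, (D.h u.1)⁻¹ α β * D.H γ α β u * u.2.2 j γ)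
    (jetOver A B) :=
  ContDiffOn.sum fun j _ => (R.g_smooth i j).mul (R.smooth_hinv_H_sum j)

theorem smooth_eulerBrace (R : D.IsRegularOn A B) (i : Fin n) :
    ContDiffOn ℝ ∞ (eulerBrace D i) (jetOver A B) :=
  ((((R.smooth_dX_dY_L_sum i).sub (R.smooth_dX R.L_smooth i)).add (R.smooth_dT_dY_L_sum i)).add
    (R.smooth_dY_L_H_sum i)).add (contDiffOn_const.mul (R.smooth_g_H_sum i))

theorem dY_dX_dY_L_sum (R : D.IsRegularOn A B) (hu : u ∈ jetOver A B) (i l : Fin n) (γ : Fin p) :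
    dY l γ (fun u => ∑ j, ∑ α, dX j (dY i α D.L) u * u.2.2 j α) u =
      (∑ j, ∑ α, 2 * ((D.h u.1)⁻¹ γ α * dX j (fun w => D.g w l i) u) * u.2.2 j α)
        + dX l (dY i γ D.L) u := by
  have hL : ∀ j α, DifferentiableAt ℝ (dX j (dY i α D.L)) u :=
    fun j α => R.diffAt (R.smooth_dX (R.smooth_dY R.L_smooth i α) j) hu
  have hy : ∀ j β, DifferentiableAt ℝ (fun w : JetCoord p n => w.2.2 j β) u :=
    fun j β => R.diffAt (smooth_y j β) hu
  rw [dY, fderiv_sum_apply' fun j => DifferentiableAt.fun_sum fun α _ => (hL j α).fun_mul (hy j α)]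
  simp only [fderiv_sum_apply' fun α => (hL _ α).fun_mul (hy _ α),
    fderiv_mul_apply (hL _ _) (hy _ _), fderiv_coord, Finset.sum_add_distrib]
  rw [add_comm]
  congr 1
  · exact Finset.sum_congr rfl fun j _ => Finset.sum_congr rfl fun α _ => by
      rw [← R.dY_dX_dY_L hu]; rfl
  · rw [Fintype.sum_eq_single l fun j hj => by simp [hj]]
    simp [Pi.single_apply]

theorem dY_dT_dY_L_sum (R : D.IsRegularOn A B) (hu : u ∈ jetOver A B) (i l : Fin n) (γ : Fin p) :
    dY l γ (fun u => ∑ α, dT α (dY i α D.L) u) u =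
      ∑ α, 2 * ((D.h u.1)⁻¹ γ α * dT α (fun w => D.g w l i) u
        + dT α (fun w : JetCoord p n => (D.h w.1)⁻¹ γ α) u * D.g u l i) := by
  rw [dY, fderiv_sum_apply' fun α => R.diffAt (R.smooth_dT (R.smooth_dY R.L_smooth i α) α) hu]
  exact Finset.sum_congr rfl fun α _ => R.dY_dT_dY_L hu l i α γ

theorem dY_dY_L_H_sum (R : D.IsRegularOn A B) (hu : u ∈ jetOver A B) (i l : Fin n) (γ : Fin p) :
    dY l γ (fun u => ∑ α, ∑ μ, dY i α D.L u * D.H μ α μ u) u =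
      ∑ α, ∑ μ, 2 * ((D.h u.1)⁻¹ γ α * D.g u l i) * D.H μ α μ u := by
  have hL : ∀ α, DifferentiableAt ℝ (dY i α D.L) u :=
    fun α => R.diffAt (R.smooth_dY R.L_smooth i α) hu
  have hH : ∀ α μ, DifferentiableAt ℝ (D.H μ α μ) u := fun α μ => R.diffAt (R.smooth_H μ α μ) hu
  rw [dY, fderiv_sum_apply' fun α => DifferentiableAt.fun_sum fun μ _ => (hL α).fun_mul (hH α μ)]
  simp only [fderiv_sum_apply' fun μ => (hL _).fun_mul (hH _ μ), fderiv_mul_apply (hL _) (hH _ _)]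
  refine Finset.sum_congr rfl fun α _ => Finset.sum_congr rfl fun μ _ => ?_
  rw [R.fderiv_H_fst hu _ _ _ rfl, ← R.dY_dY_L hu, mul_zero, zero_add, dY]

theorem dY_g_H_sum (R : D.IsRegularOn A B) (hp : 2 ≤ p) (hu : u ∈ jetOver A B) (i l : Fin n)
    (γ : Fin p) :
    dY l γ (fun u => ∑ j, D.g u i j *
      ∑ α, ∑ β, ∑ μ, (D.h u.1)⁻¹ α β * D.H μ α β u * u.2.2 j μ) u =
        D.g u i l * ∑ α, ∑ β, (D.h u.1)⁻¹ α β * D.H γ α β u := by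
  have hg : ∀ j, DifferentiableAt ℝ (fun w => D.g w i j) u := fun j => R.diffAt (R.g_smooth i j) hu
  have hS : ∀ j, DifferentiableAt ℝ (fun u : JetCoord p n => ∑ α, ∑ β, ∑ μ,
      (D.h u.1)⁻¹ α β * D.H μ α β u * u.2.2 j μ) u := fun j => R.diffAt (R.smooth_hinv_H_sum j) hu
  have hc : ∀ μ α β, DifferentiableAt ℝ (fun u : JetCoord p n => (D.h u.1)⁻¹ α β * D.H μ α β u) u :=
    fun μ α β => R.diffAt ((R.smooth_hinv α β).mul (R.smooth_H μ α β)) hu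
  have hc0 : ∀ μ α β, fderiv ℝ (fun u : JetCoord p n => (D.h u.1)⁻¹ α β * D.H μ α β u) u
      (0, 0, Pi.single l (Pi.single γ 1)) = 0 := fun μ α β =>
    fderiv_eq_zero_of_line (hc μ α β) fun s => by
      rw [H_translate _ _ _ (by simp)]
      simp
  have hy : ∀ j β, DifferentiableAt ℝ (fun w : JetCoord p n => w.2.2 j β) u :=
    fun j β => R.diffAt (smooth_y j β) hu
  have hdS : ∀ j, fderiv ℝ (fun u : JetCoord p n => ∑ α, ∑ β, ∑ μ,
      (D.h u.1)⁻¹ α β * D.H μ α β u * u.2.2 j μ) u (0, 0, Pi.single l (Pi.single γ 1)) =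
        if j = l then ∑ α, ∑ β, (D.h u.1)⁻¹ α β * D.H γ α β u else 0 := by
    intro j
    rw [fderiv_sum_apply' fun α => DifferentiableAt.fun_sum fun β _ =>
      DifferentiableAt.fun_sum fun μ _ => (hc μ α β).fun_mul (hy j μ)]
    simp only [fderiv_sum_apply' fun β => DifferentiableAt.fun_sum fun μ _ =>
        (hc μ _ β).fun_mul (hy j μ),
      fderiv_sum_apply' fun μ => (hc μ _ _).fun_mul (hy j μ),
      fderiv_mul_apply (hc _ _ _) (hy _ _), hc0, fderiv_coord]
    by_cases h : j = l
    · subst h; simp [Pi.single_apply]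
    · simp [h]
  have hg0 : ∀ j, fderiv ℝ (fun w => D.g w i j) u (0, 0, Pi.single l (Pi.single γ 1)) = 0 :=
    fun j => R.dY_g hp hu l γ i j
  rw [dY, fderiv_sum_apply' fun j => (hg j).fun_mul (hS j)]
  simp only [fderiv_mul_apply (hg _) (hS _), hdS, hg0]
  simp

/-- The two mixed terms `∂²L/∂x∂y` supply the curl of `U` and, with the derivative of the Hessian,
the Christoffel combination of `g`. -/
theorem dY_eulerBrace (R : D.IsRegularOn A B) (hp : 2 ≤ p) (hu : u ∈ jetOver A B) (i l : Fin n)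
    (γ : Fin p) : dY l γ (eulerBrace D i) u =
      (∑ α, (D.h u.1)⁻¹ γ α * (2 * ((∑ j, (dX j (fun w => D.g w i l) u
        + dX l (fun w => D.g w i j) u - dX i (fun w => D.g w l j) u) * u.2.2 j α)
          + dT α (fun w => D.g w i l) u))) + D.curlU i γ l u := by
  have h1 := R.diffAt (R.smooth_dX_dY_L_sum i) hu
  have h2 := R.diffAt (R.smooth_dX R.L_smooth i) hu
  have h3 := R.diffAt (R.smooth_dT_dY_L_sum i) hu
  have h4 := R.diffAt (R.smooth_dY_L_H_sum i) hu
  have h5 := R.diffAt (R.smooth_g_H_sum i) hu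
  have hsplit : dY l γ (eulerBrace D i) u =
      dY l γ (fun u => ∑ j, ∑ α, dX j (dY i α D.L) u * u.2.2 j α) u - dX i (dY l γ D.L) u
      + dY l γ (fun u => ∑ α, dT α (dY i α D.L) u) u
      + dY l γ (fun u => ∑ α, ∑ μ, dY i α D.L u * D.H μ α μ u) u
      + 2 * dY l γ (fun u => ∑ j, D.g u i j *
          ∑ α, ∑ β, ∑ μ, (D.h u.1)⁻¹ α β * D.H μ α β u * u.2.2 j μ) u := by
    have hcomm : dY l γ (dX i D.L) u = dX i (dY l γ D.L) u :=
      fderiv_comm R.isOpen R.L_smooth hu _ _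
    rw [← hcomm]
    have h6 : eulerBrace D i = fun u => (∑ j, ∑ α, dX j (dY i α D.L) u * u.2.2 j α) - dX i D.L u
      + (∑ α, dT α (dY i α D.L) u)
      + (∑ α, ∑ γ, dY i α D.L u * D.H γ α γ u)
      + 2 * ∑ j, D.g u i j * ∑ α, ∑ β, ∑ γ, (D.h u.1)⁻¹ α β * D.H γ α β u * u.2.2 j γ := rfl
    rw [h6]
    simp only [dY]
    simp only [dY] at h1 h2 h3 h4 h5
    rw [fderiv_add_apply' (((h1.fun_sub h2).fun_add h3).fun_add h4) (h5.const_mul 2),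
      fderiv_add_apply' ((h1.fun_sub h2).fun_add h3) h4, fderiv_add_apply' (h1.fun_sub h2) h3,
      fderiv_sub_apply' h1 h2, fderiv_const_mul_apply h5]
  have tr := R.trace_dT_hinv hu γ
  rw [hsplit, R.dY_dX_dY_L_sum hu, R.dY_dT_dY_L_sum hu, R.dY_dY_L_H_sum hu, R.dY_g_H_sum hp hu,
    R.dX_dY_L hp hu, R.dX_dY_L hp hu, curlU]
  have e1 : ∑ α, 2 * ((D.h u.1)⁻¹ γ α * dT α (fun w => D.g w l i) u
        + dT α (fun w : JetCoord p n => (D.h w.1)⁻¹ γ α) u * D.g u l i) =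
      (∑ α, (D.h u.1)⁻¹ γ α * (2 * dT α (fun w => D.g w i l) u))
        + 2 * D.g u i l * ∑ α, dT α (fun w : JetCoord p n => (D.h w.1)⁻¹ γ α) u := by
    rw [Finset.mul_sum, ← Finset.sum_add_distrib]
    refine Finset.sum_congr rfl fun α _ => ?_
    simp only [fun w => R.g_symm w l i]
    ring
  have e2 : ∑ α, ∑ μ, 2 * ((D.h u.1)⁻¹ γ α * D.g u l i) * D.H μ α μ u =
      2 * D.g u i l * ∑ α, ∑ μ, (D.h u.1)⁻¹ γ α * D.H μ α μ u := by
    simp only [Finset.mul_sum, R.g_symm u l i]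
    exact Finset.sum_congr rfl fun α _ => Finset.sum_congr rfl fun μ _ => by ring
  have e3 : (∑ α, (D.h u.1)⁻¹ γ α * (2 * ((∑ j, (dX j (fun w => D.g w i l) u
        + dX l (fun w => D.g w i j) u - dX i (fun w => D.g w l j) u) * u.2.2 j α)
          + dT α (fun w => D.g w i l) u))) =
      (∑ j, ∑ α, 2 * ((D.h u.1)⁻¹ γ α * dX j (fun w => D.g w l i) u) * u.2.2 j α)
      + (∑ j, ∑ α, 2 * ((D.h u.1)⁻¹ γ α * dX l (fun w => D.g w i j) u) * u.2.2 j α)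
      - (∑ j, ∑ α, 2 * ((D.h u.1)⁻¹ γ α * dX i (fun w => D.g w l j) u) * u.2.2 j α)
      + ∑ α, (D.h u.1)⁻¹ γ α * (2 * dT α (fun w => D.g w i l) u) := by
    rw [← Finset.sum_add_distrib, ← Finset.sum_sub_distrib]
    simp only [← Finset.sum_add_distrib, ← Finset.sum_sub_distrib]
    rw [Finset.sum_comm, ← Finset.sum_add_distrib]
    refine Finset.sum_congr rfl fun α _ => ?_
    simp only [fun w => R.g_symm w l i]
    rw [mul_add, mul_add, Finset.mul_sum, Finset.mul_sum]
    congr 1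
    exact Finset.sum_congr rfl fun j _ => by ring
  rw [e1, e2, e3]
  -- The leftover terms are `2 g_{il}` times the trace identity.
  linear_combination 2 * D.g u i l * tr

/-- For several times, `N^{(m)}_{(μ)l} = Γ^m_{lk} x^k_μ + F^m_{l(μ)}`. -/
theorem N_eq (R : D.IsRegularOn A B) (hp : 2 ≤ p) (hu : u ∈ jetOver A B) (m : Fin n) (μ : Fin p)
    (l : Fin n) : D.N m μ l u = (∑ k, D.Gam m l k u * u.2.2 k μ) + D.F m l μ u := by
  have hspray : ∀ γ, dY l γ (D.spray m) u =
      (1 / 2) * ((1 / 2) * ∑ i, (D.g u)⁻¹ m i * dY l γ (eulerBrace D i) u) := by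
    intro γ
    have hg : ∀ i, DifferentiableAt ℝ (fun w => (D.g w)⁻¹ m i) u :=
      fun i => R.diffAt (R.smooth_ginv m i) hu
    have hE : ∀ i, DifferentiableAt ℝ (eulerBrace D i) u :=
      fun i => R.diffAt (R.smooth_eulerBrace i) hu
    have h : D.spray m = fun u => (1 / 2) * ((1 / 2) * ∑ i, (D.g u)⁻¹ m i * eulerBrace D i u) := rfl
    have hsum : DifferentiableAt ℝ (fun u => ∑ i, (D.g u)⁻¹ m i * eulerBrace D i u) u :=
      DifferentiableAt.fun_sum fun i _ => (hg i).fun_mul (hE i)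
    rw [h, dY, fderiv_const_mul_apply (hsum.const_mul _), fderiv_const_mul_apply hsum,
      fderiv_sum_apply' fun i => (hg i).fun_mul (hE i)]
    simp only [fderiv_mul_apply (hg _) (hE _),
      R.fderiv_eq_zero_of_fibreConst (R.smooth_ginv m _) (R.fibreConst_ginv hp m _) hu, zero_mul,
      add_zero]
    rfl
  -- The factor `h_{μγ}` in `N` cancels the `h^{γα}` of `dY_eulerBrace`.
  have hlow : ∀ i, ∑ γ, D.h u.1 μ γ * dY l γ (eulerBrace D i) u =
      2 * ((∑ j, (dX j (fun w => D.g w i l) u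
        + dX l (fun w => D.g w i j) u - dX i (fun w => D.g w l j) u) * u.2.2 j μ)
          + dT μ (fun w => D.g w i l) u) + ∑ γ, D.h u.1 μ γ * D.curlU i γ l u := by
    intro i
    simp only [R.dY_eulerBrace hp hu, mul_add (D.h u.1 μ _), Finset.sum_add_distrib]
    rw [sum_mul_sum_inv_mul (R.h_det u.1 hu.1) (fun α => 2 * ((∑ j, (dX j (fun w => D.g w i l) u
        + dX l (fun w => D.g w i j) u - dX i (fun w => D.g w l j) u) * u.2.2 j α)
          + dT α (fun w => D.g w i l) u))]
  have hN : D.N m μ l u =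
      ∑ i, (D.g u)⁻¹ m i * ((1 / 4) * ∑ γ, D.h u.1 μ γ * dY l γ (eulerBrace D i) u) := by
    simp only [N, hspray, Finset.mul_sum]
    rw [Finset.sum_comm]
    exact Finset.sum_congr rfl fun i _ => Finset.sum_congr rfl fun γ _ => by ring
  rw [hN]
  simp only [hlow, Gam, F, Finset.sum_mul, Finset.mul_sum (s := Finset.univ) (a := (1 / 2 : ℝ))]
  rw [Finset.sum_comm, ← Finset.sum_add_distrib]
  refine Finset.sum_congr rfl fun i _ => ?_
  have hG : ∑ k, 1 / 2 * ((D.g u)⁻¹ m i * (dX k (fun w => D.g w i l) u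
      + dX l (fun w => D.g w i k) u - dX i (fun w => D.g w l k) u)) * u.2.2 k μ =
      1 / 2 * (D.g u)⁻¹ m i * ∑ k, (dX k (fun w => D.g w i l) u
      + dX l (fun w => D.g w i k) u - dX i (fun w => D.g w l k) u) * u.2.2 k μ := by
    rw [Finset.mul_sum]
    exact Finset.sum_congr rfl fun k _ => by ring
  rw [hG, ← Finset.mul_sum]
  ring

/-! ## Several times: the coefficients of the connection and the torsion -/

variable {cov : ConnOp p n}

theorem deltaX_of_fibreConst (R : D.IsRegularOn A B) {f : JetCoord p n → ℝ}
    (hs : ContDiffOn ℝ ∞ f (jetOver A B)) (hf : FibreConst (jetOver A B) f) (hu : u ∈ jetOver A B)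
    (i : Fin n) : D.deltaX i f u = dX i f u :=
  R.fderiv_of_fibreConst hs hf hu _

/-- Since `δg/δx = ∂g/∂x`, the Cartan conditions on `L^k_{ij}` are those that characterize the
Christoffel symbols. -/
theorem coefL_eq (R : D.IsRegularOn A B) (hp : 2 ≤ p) (hc : D.IsCartan (jetOver A B) cov)
    (hu : u ∈ jetOver A B) (l j k : Fin n) : D.coefL cov l j k u = D.Gam l j k u := by
  refine christoffel_unique (g := D.g u) (A := fun k i j => dX k (fun w => D.g w i j) u)
    (Λ := fun l j k => D.coefL cov l j k u) (R.g_det u hu) (R.g_symm u) (hc.symmL u hu)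
    (fun k i j => ?_) l j k
  have h := hc.metricX u hu i j k
  rw [R.deltaX_of_fibreConst (R.g_smooth i j) (R.fibreConst_g hp i j) hu] at h
  linarith

theorem coefC_eq_zero (R : D.IsRegularOn A B) (hp : 2 ≤ p) (hc : D.IsCartan (jetOver A B) cov)
    (hu : u ∈ jetOver A B) (l j k : Fin n) (γ : Fin p) : D.coefC cov l j k γ u = 0 := by
  refine eq_zero_of_metric (g := D.g u) (Λ := fun l j k => D.coefC cov l j k γ u) (R.g_det u hu)
    (R.g_symm u) (fun l i j => hc.symmC u hu l i j γ) (fun k i j => ?_) l j k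
  have h := hc.metricV u hu i j k γ
  rw [R.dY_g hp hu] at h
  linarith

theorem Gam_symm (R : D.IsRegularOn A B) (l j k : Fin n) (u : JetCoord p n) :
    D.Gam l j k u = D.Gam l k j u := by
  simp only [Gam, fun w : JetCoord p n => R.g_symm w j k]
  congr 1
  exact Finset.sum_congr rfl fun i _ => by ring

theorem fderiv_N (R : D.IsRegularOn A B) (hp : 2 ≤ p) (hu : u ∈ jetOver A B) (m : Fin n)
    (μ : Fin p) (l : Fin n) (v : JetCoord p n) : fderiv ℝ (D.N m μ l) u v =
      (∑ k, (D.Gam m l k u * v.2.2 k μ + fderiv ℝ (D.Gam m l k) u v * u.2.2 k μ))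
        + fderiv ℝ (D.F m l μ) u v := by
  have hG : ∀ k, DifferentiableAt ℝ (D.Gam m l k) u := fun k => R.diffAt (R.smooth_Gam m l k) hu
  have hy : ∀ k, DifferentiableAt ℝ (fun w : JetCoord p n => w.2.2 k μ) u :=
    fun k => R.diffAt (smooth_y k μ) hu
  rw [fderiv_congr_on R.isOpen (fun w hw => R.N_eq hp hw m μ l) hu,
    fderiv_add_apply' (DifferentiableAt.fun_sum fun k _ => (hG k).fun_mul (hy k))
      (R.diffAt (R.smooth_F m l μ) hu), fderiv_sum_apply' fun k => (hG k).fun_mul (hy k)]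
  simp only [fderiv_mul_apply (hG _) (hy _), fderiv_coord]

theorem dY_N (R : D.IsRegularOn A B) (hp : 2 ≤ p) (hu : u ∈ jetOver A B) (m : Fin n)
    (μ : Fin p) (l k : Fin n) (η : Fin p) :
    dY k η (D.N m μ l) u = if μ = η then D.Gam m l k u else 0 := by
  rw [dY, R.fderiv_N hp hu]
  simp only [R.fderiv_eq_zero_of_fibreConst (R.smooth_Gam m l _) (R.fibreConst_Gam hp m l _) hu,
    R.fderiv_eq_zero_of_fibreConst (R.smooth_F m l μ) (R.fibreConst_F hp m l μ) hu]
  rw [Fintype.sum_eq_single k fun j hj => by simp [hj]]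
  simp [Pi.single_apply]

theorem deltaX_N (R : D.IsRegularOn A B) (hp : 2 ≤ p) (hu : u ∈ jetOver A B) (m : Fin n)
    (μ : Fin p) (i j : Fin n) : D.deltaX j (D.N m μ i) u =
      (∑ k, (dX j (D.Gam m i k) u - ∑ l, D.Gam m i l u * D.Gam l j k u) * u.2.2 k μ)
        + (D.deltaX j (D.F m i μ) u - ∑ l, D.Gam m i l u * D.F l j μ u) := by
  have hG : ∀ k, fderiv ℝ (D.Gam m i k) u (D.eX j u) = dX j (D.Gam m i k) u := fun k =>
    R.deltaX_of_fibreConst (R.smooth_Gam m i k) (R.fibreConst_Gam hp m i k) hu j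
  have he : ∀ k, (D.eX j u).2.2 k μ = -D.N k μ j u := fun k => rfl
  rw [deltaX, R.fderiv_N hp hu]
  simp only [hG, he, R.N_eq hp hu, mul_neg, mul_add, neg_add, sub_mul, Finset.sum_add_distrib,
    Finset.sum_sub_distrib, Finset.sum_neg_distrib, Finset.mul_sum, Finset.sum_mul, deltaX]
  rw [Finset.sum_comm (f := fun k l => D.Gam m i k u * (D.Gam k j l u * u.2.2 l μ))]
  simp only [mul_assoc]
  ring

/-- The sum `H Γ y` cancels the same part of `δM/δx = H N` in the torsion, so that only `H F`
survives. -/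
theorem deltaT_N (R : D.IsRegularOn A B) (hp : 2 ≤ p) (hu : u ∈ jetOver A B) (m : Fin n)
    (μ α : Fin p) (j : Fin n) : D.deltaT α (D.N m μ j) u =
      dT α (D.N m μ j) u + ∑ β, D.H β μ α u * ∑ k, D.Gam m j k u * u.2.2 k β := by
  rw [deltaT_eq]
  simp only [R.dY_N hp hu, mul_ite, mul_zero, Finset.sum_ite_eq, Finset.mem_univ, if_true, M,
    neg_mul, Finset.sum_neg_distrib, sub_neg_eq_add, Finset.mul_sum, Finset.sum_mul]
  rw [Finset.sum_comm]
  congr 1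
  exact Finset.sum_congr rfl fun β _ => Finset.sum_congr rfl fun k _ => by ring

/-- The torsion components for several temporal variables. -/
theorem torsion_several_times (R : D.IsRegularOn A B) (hp : 2 ≤ p)
    (hc : D.IsCartan (jetOver A B) cov) (hu : u ∈ jetOver A B) (α β : Fin p) (i j : Fin n) :
    torsion cov (D.eT β) (D.eT α) u = D.vec u 0 0
        (fun m μ => -∑ γ, D.curvH γ μ α β u * u.2.2 m γ) ∧
      torsion cov (D.eX j) (D.eT α) u = D.vec u 0
        (fun m => -D.coefG cov m j α u)
        (fun m μ => -dT α (D.N m μ j) u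
          + ∑ k, (D.g u)⁻¹ m k / 2 * ∑ β, D.H β μ α u *
            (dT β (fun w => D.g w j k) u
              + ∑ γ, D.h u.1 β γ / 2 * D.curlU k γ j u)) ∧
      torsion cov (D.eX j) (D.eX i) u = D.vec u 0 0
        (fun m μ => (∑ k, D.curvG m k i j u * u.2.2 k μ)
          + (D.covF cov m i μ j u - D.covF cov m j μ i u)) ∧
      torsion cov (D.eV j β) (D.eT α) u = D.vec u 0 0
        (fun m μ => -(if μ = β then 1 else 0) * D.coefG cov m j α u) ∧
      torsion cov (D.eV j β) (D.eX i) u = 0 ∧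
      torsion cov (D.eV j β) (D.eV i α) u = 0 := by
  have hn := hc.toIsHNormal
  refine ⟨?_, ?_, ?_, R.torsion_eV_eT hn hu α β j, ?_, ?_⟩
  · rw [R.torsion_eT_eT hn hu]
    congr 1
    funext m μ
    rw [R.deltaT_M hu, R.deltaT_M hu, sub_neg_eq_add, neg_add_eq_sub, ← Finset.sum_sub_distrib,
      ← Finset.sum_neg_distrib]
    refine Finset.sum_congr rfl fun γ _ => ?_
    rw [curvH]
    ring
  · rw [R.torsion_eX_eT hn hu]
    congr 1
    funext m μ
    have hF : ∑ k, (D.g u)⁻¹ m k / 2 * ∑ β, D.H β μ α u * (dT β (fun w => D.g w j k) u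
        + ∑ γ, D.h u.1 β γ / 2 * D.curlU k γ j u) = ∑ β, D.H β μ α u * D.F m j β u := by
      have h2 : ∀ k β, ∑ γ, D.h u.1 β γ / 2 * D.curlU k γ j u =
          1 / 2 * ∑ γ, D.h u.1 β γ * D.curlU k γ j u := by
        intro k β
        rw [Finset.mul_sum]
        exact Finset.sum_congr rfl fun γ _ => by ring
      have h3 : ∀ β, D.H β μ α u * D.F m j β u = ∑ k, D.H β μ α u * ((D.g u)⁻¹ m k / 2 *
          (dT β (fun w => D.g w k j) u + 1 / 2 * ∑ γ, D.h u.1 β γ * D.curlU k γ j u)) :=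
        fun β => Finset.mul_sum _ _ _
      simp only [h2, h3]
      rw [Finset.sum_comm]
      refine Finset.sum_congr rfl fun k _ => ?_
      rw [Finset.mul_sum]
      refine Finset.sum_congr rfl fun β _ => ?_
      simp only [fun w : JetCoord p n => R.g_symm w j k]
      ring
    rw [hF, R.deltaX_M hu, R.deltaT_N hp hu]
    simp only [R.N_eq hp hu m _ j, mul_add, Finset.sum_add_distrib]
    ring
  · rw [R.torsion_eX_eX hc hu]
    congr 1
    funext m μ
    -- The part linear in `y` of `δN/δx`, antisymmetrized in `i` and `j`, is the curvature of `Γ`.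
    have hr : ∀ k, D.curvG m k i j u =
        (dX j (D.Gam m i k) u - ∑ l, D.Gam m i l u * D.Gam l j k u)
          - (dX i (D.Gam m j k) u - ∑ l, D.Gam m j l u * D.Gam l i k u) := by
      intro k
      have hsym : ∀ i, D.Gam m k i = D.Gam m i k := fun i => funext (R.Gam_symm m k i)
      simp only [curvG, hsym, fun l => R.Gam_symm l k i u, fun l => R.Gam_symm l k j u,
        fun l => R.Gam_symm m l i u, fun l => R.Gam_symm m l j u, mul_comm (D.Gam _ i k u),
        mul_comm (D.Gam _ j k u)]
      ring
    -- The terms `F^m_k L^k_{ij}` of the two covariant derivatives cancel by this symmetry; the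
    -- terms `F^k L^m` match the products `Γ F` from `deltaX_N`.
    have hl : ∀ k, D.coefL cov k i j u = D.coefL cov k j i u := fun k => hc.symmL u hu k i j
    rw [R.deltaX_N hp hu, R.deltaX_N hp hu, covF, covF]
    simp only [hl, hr, sub_mul, Finset.sum_sub_distrib]
    simp only [R.coefL_eq hp hc hu, fun l => R.Gam_symm m l i u, fun l => R.Gam_symm m l j u,
      mul_comm (D.F _ _ _ u) (D.Gam m _ _ u)]
    ring
  · rw [R.torsion_eV_eX hn hu, vec_eq]
    simp only [R.coefC_eq_zero hp hc hu, R.dY_N hp hu, R.coefL_eq hp hc hu,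
      fun m => R.Gam_symm m i j u, sub_self]
    refine Prod.ext rfl (Prod.ext rfl ?_)
    funext m μ
    simp
  · rw [R.torsion_eV_eV hn hu, vec_vertical]
    simp only [R.coefC_eq_zero hp hc hu, ite_self, sub_self]
    rfl

end IsRegularOn

end LocalData

/-! ## The local expressions of a Lagrange space -/

section Bridge

theorem det_ne_zero_of_nondegenerate {d : ℕ} {V : Type*} [AddCommGroup V] [Module ℝ V]
    (e : (Fin d → ℝ) ≃ₗ[ℝ] V) {b : LinearMap.BilinForm ℝ V} (hb : b.Nondegenerate) :
    (Matrix.of fun i j => b (e (Pi.single i 1)) (e (Pi.single j 1))).det ≠ 0 := by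
  let B : Module.Basis (Fin d) ℝ V := (Pi.basisFun ℝ (Fin d)).map e
  have h := (LinearMap.BilinForm.nondegenerate_iff_det_ne_zero B).1 hb
  convert h using 2
  ext i j
  simp [B, LinearMap.BilinForm.toMatrix_apply]

theorem mdifferentiable_of_mem_maximalAtlas {d : ℕ} {X : Type*} [TopologicalSpace X]
    [ChartedSpace (Fin d → ℝ) X] [IsManifold 𝓘(ℝ, Fin d → ℝ) ∞ X]
    {ψ : OpenPartialHomeomorph X (Fin d → ℝ)}
    (hψ : ψ ∈ IsManifold.maximalAtlas 𝓘(ℝ, Fin d → ℝ) ∞ X) :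
    ψ.MDifferentiable 𝓘(ℝ, Fin d → ℝ) 𝓘(ℝ, Fin d → ℝ) :=
  ⟨(contMDiffOn_of_mem_maximalAtlas hψ).mdifferentiableOn (by simp),
    (contMDiffOn_symm_of_mem_maximalAtlas hψ).mdifferentiableOn (by simp)⟩

theorem det_coordVec_ne_zero {d : ℕ} {X : Type*} [TopologicalSpace X]
    [ChartedSpace (Fin d → ℝ) X] [IsManifold 𝓘(ℝ, Fin d → ℝ) ∞ X]
    {ψ : OpenPartialHomeomorph X (Fin d → ℝ)}
    (hψ : ψ ∈ IsManifold.maximalAtlas 𝓘(ℝ, Fin d → ℝ) ∞ X) {x : Fin d → ℝ} (hx : x ∈ ψ.target)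
    {b : LinearMap.BilinForm ℝ (TangentSpace 𝓘(ℝ, Fin d → ℝ) (ψ.symm x))} (hb : b.Nondegenerate) :
    (Matrix.of fun i j => b (coordVec ψ x i) (coordVec ψ x j)).det ≠ 0 := by
  -- The differential of the inverse chart is an isomorphism, so the coordinate vectors form a
  -- basis.
  let e := (mdifferentiable_of_mem_maximalAtlas hψ).symm.mfderiv (x := x) hx
  exact det_ne_zero_of_nondegenerate (d := d) e.toLinearEquiv hb

variable {p n : ℕ}
  {T : Type*} [TopologicalSpace T] [ChartedSpace (Fin p → ℝ) T]
  [IsManifold 𝓘(ℝ, Fin p → ℝ) ∞ T]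
  {M : Type*} [TopologicalSpace M] [ChartedSpace (Fin n → ℝ) M]
  [IsManifold 𝓘(ℝ, Fin n → ℝ) ∞ M]

theorem LagrangeSpace.isRegularOn_loc (S : LagrangeSpace p n T M)
    {φ : OpenPartialHomeomorph T (Fin p → ℝ)}
    (hφ : φ ∈ IsManifold.maximalAtlas 𝓘(ℝ, Fin p → ℝ) ∞ T)
    {ψ : OpenPartialHomeomorph M (Fin n → ℝ)}
    (hψ : ψ ∈ IsManifold.maximalAtlas 𝓘(ℝ, Fin n → ℝ) ∞ M) :
    (S.loc φ ψ).IsRegularOn φ.target ψ.target where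
  openA := φ.open_target
  openB := ψ.open_target
  h_symm _ _ _ := (S.h_symm _).eq _ _
  h_det _ ht := det_coordVec_ne_zero hφ ht (S.h_nondeg _)
  h_smooth := S.h_smooth φ hφ ψ hψ
  g_symm _ _ _ := (S.g_symm _).eq _ _
  g_det u hu := det_coordVec_ne_zero hψ hu.2 (S.g_nondeg (jetOf φ ψ u))
  g_smooth := S.g_smooth φ hφ ψ hψ
  L_smooth := S.L_smooth φ hφ ψ hψ
  hess := S.regular φ hφ ψ hψ

end Bridge

end MultiTime

theorem mainTheorem6 (p n : ℕ)
    (T : Type*) [TopologicalSpace T] [ChartedSpace (Fin p → ℝ) T]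
    [IsManifold 𝓘(ℝ, Fin p → ℝ) ∞ T]
    (M : Type*) [TopologicalSpace M] [ChartedSpace (Fin n → ℝ) M]
    [IsManifold 𝓘(ℝ, Fin n → ℝ) ∞ M]
    (S : MultiTime.LagrangeSpace p n T M)
    (φ : OpenPartialHomeomorph T (Fin p → ℝ))
    (hφ : φ ∈ IsManifold.maximalAtlas 𝓘(ℝ, Fin p → ℝ) ∞ T)
    (ψ : OpenPartialHomeomorph M (Fin n → ℝ))
    (hψ : ψ ∈ IsManifold.maximalAtlas 𝓘(ℝ, Fin n → ℝ) ∞ M)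
    (D : MultiTime.LocalData p n) (hD : D = S.loc φ ψ)
    (cov : MultiTime.ConnOp p n)
    (hcov : D.IsCartan (MultiTime.chartDomain φ ψ) cov) :
    -- the torsion is a tensor, determined by its components in the adapted basis
    (∀ u ∈ MultiTime.chartDomain φ ψ, ∀ X Y : MultiTime.VF p n,
      ContDiffOn ℝ ∞ X (MultiTime.chartDomain φ ψ) →
      ContDiffOn ℝ ∞ Y (MultiTime.chartDomain φ ψ) →
      MultiTime.torsion cov X Y u =
        ∑ a, ∑ b, (D.coframe u (X u) a * D.coframe u (Y u) b) •
          MultiTime.torsion cov (D.frame a) (D.frame b) u) ∧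
    -- one time; every index in `Fin p` is the index `1`
    (p = 1 → ∀ u ∈ MultiTime.chartDomain φ ψ, ∀ (o : Fin p) (i j : Fin n),
      -- row `h_T h_T`
      MultiTime.torsion cov (D.eT o) (D.eT o) u = 0 ∧
      -- row `h_M h_T`
      MultiTime.torsion cov (D.eX j) (D.eT o) u = D.vec u 0
        (fun m => -D.coefG cov m j o u)
        (fun m _ => -MultiTime.dT o (D.N m o j) u
          + D.H o o o u * (D.N m o j u
            - ∑ k, MultiTime.dY k o (D.N m o j) u * u.2.2 k o)) ∧
      -- row `h_M h_M`
      MultiTime.torsion cov (D.eX j) (D.eX i) u = D.vec u 0 0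
        (fun m _ => D.deltaX j (D.N m o i) u - D.deltaX i (D.N m o j) u) ∧
      -- row `v h_T`
      MultiTime.torsion cov (D.eV j o) (D.eT o) u = D.vec u 0 0
        (fun m _ => -D.coefG cov m j o u) ∧
      -- row `v h_M`
      MultiTime.torsion cov (D.eV j o) (D.eX i) u = D.vec u 0
        (fun m => D.coefC cov m i j o u)
        (fun m _ => MultiTime.dY j o (D.N m o i) u - D.coefL cov m j i u) ∧
      -- row `v v`
      MultiTime.torsion cov (D.eV j o) (D.eV i o) u = 0) ∧
    -- several times
    (2 ≤ p → ∀ u ∈ MultiTime.chartDomain φ ψ,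
      -- `g` depends on `(t, x)` only, and `L` has the coefficients `g`, `U` and `F`
      (∀ y, D.g (u.1, u.2.1, y) = D.g u) ∧
      D.L u = (∑ i, ∑ j, ∑ α, ∑ β, (D.h u.1)⁻¹ α β * D.g u i j * u.2.2 i α * u.2.2 j β)
        + (∑ i, ∑ α, D.U i α u * u.2.2 i α) + D.pot u ∧
      ∀ (α β : Fin p) (i j : Fin n),
      -- row `h_T h_T`
      MultiTime.torsion cov (D.eT β) (D.eT α) u = D.vec u 0 0
        (fun m μ => -∑ γ, D.curvH γ μ α β u * u.2.2 m γ) ∧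
      -- row `h_M h_T`
      MultiTime.torsion cov (D.eX j) (D.eT α) u = D.vec u 0
        (fun m => -D.coefG cov m j α u)
        (fun m μ => -MultiTime.dT α (D.N m μ j) u
          + ∑ k, (D.g u)⁻¹ m k / 2 * ∑ β, D.H β μ α u *
            (MultiTime.dT β (fun w => D.g w j k) u
              + ∑ γ, D.h u.1 β γ / 2 * D.curlU k γ j u)) ∧
      -- row `h_M h_M`
      MultiTime.torsion cov (D.eX j) (D.eX i) u = D.vec u 0 0
        (fun m μ => (∑ k, D.curvG m k i j u * u.2.2 k μ)
          + (D.covF cov m i μ j u - D.covF cov m j μ i u)) ∧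
      -- row `v h_T`
      MultiTime.torsion cov (D.eV j β) (D.eT α) u = D.vec u 0 0
        (fun m μ => -(if μ = β then 1 else 0) * D.coefG cov m j α u) ∧
      -- row `v h_M`
      MultiTime.torsion cov (D.eV j β) (D.eX i) u = 0 ∧
      -- row `v v`
      MultiTime.torsion cov (D.eV j β) (D.eV i α) u = 0) := by
  subst hD
  -- `chartDomain φ ψ` is by definition `jetOver φ.target ψ.target`, so the local results apply
  -- directly.
  have R := S.isRegularOn_loc hφ hψ
  refine ⟨fun u hu X Y hX hY =>
      R.torsion_eq_sum hcov.toIsLinearConnection hu hX hY,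
    fun hp u hu o i j => R.torsion_one_time hcov hp hu o i j,
    fun hp u hu => ⟨R.g_fibre hp hu, R.L_eq hp hu, fun α β i j =>
      R.torsion_several_times hp hcov hu α β i j⟩⟩
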